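/- Let $n\ge 1$, let $\mathfrak S_n$ be the symmetric group on $[n]=\{1,\dots,n\}$, and let $X_n=\sum_{1\le j<n}(j\,n)\in\mathbb C\mathfrak S_n$ be the Young-Jucys-Murphy element. For $r\ge 0$ the transitive power $\mathsf T X_n^r$ is obtained by expanding $X_n^r$ formally as the sum of all words $\tau_1\cdots\tau_r$ in the transpositions $(j\,n)$, $1\le j<n$, and adding up the products $\tau_1\cdots\tau_r\in\mathfrak S_n$ of those words for which the group generated by $\tau_1,\dots,\tau_r$ acts transitively on $[n]$. For $\alpha\vdash n$ let $\mathsf K_\alpha\in\mathbb C\mathfrak S_n$ be the sum of all permutations of cycle type $\alpha$, let $l(\alpha)$ be the number of parts of $\alpha$, and let $p_i(\alpha)$ be the $i$-th power sum of the parts of $\alpha$. Put $q_i=p_i+p_1-2$. Define rational numbers $\xi_{2j}$ by $$\sum_{j\ge 1}\xi_{2j}x^{2j}=\log\left(2x^{-1}\sinh(x/2)\right).$$ For a partition $\beta=(\beta_1,\dots,\beta_k)$ put $\xi_{2\beta}=\prod_i\xi_{2\beta_i}$ and $q_{2\beta}=\prod_i q_{2\beta_i}$, and let $|\mathrm{Aut}\,\beta|=\prod_{j}f_j!$,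 where $f_j$ is the number of parts of $\beta$ equal to $j$. For $g\ge 0$ and $\alpha=(\alpha_1,\dots,\alpha_m)\vdash n$ with $m=l(\alpha)$ set $$a_g(\alpha)=\frac{(n+m-2+2g)!}{n!}\,\alpha_1\cdots\alpha_m\,Q_g(\alpha),\qquad Q_g=\sum_{\beta\vdash g}\frac{\xi_{2\beta}\,q_{2\beta}}{|\mathrm{Aut}\,\beta|}.$$ Then the following hold. 1. For all $n\ge 1$ and $r\ge 0$, $\mathsf T X_n^r$ lies in the centre $Z(n)$ of $\mathbb C\mathfrak S_n$, and $$\mathsf T X_n^r=\sum a_g(\alpha)\,\mathsf K_\alpha ,$$ where the sum is over all $\alpha\vdash n$ and $g\ge 0$ with $n+l(\alpha)-2+2g=r$. 2. For fixed $g\ge 0$ and $m\ge 1$, $a_g(\alpha)$ is a polynomial (with rational coefficients) in the parts $\alpha_1,\dots,\alpha_m$. 3. For every $\alpha\vdash n$ with $m$ parts, every $g\ge 0$, every $\sigma\in\mathfrak S_n$ of cycle type $\alpha$ and every pivot $i\in[n]$, $a_g(\alpha)$ is the number of sequences $(\tau_1,\dots,\tau_r)$ of $r=n+m-2+2g$ star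 transpositions $(i\,c)$, $c\in[n]\setminus\{i\}$, such that $\tau_1\cdots\tau_r=\sigma$ and the group generated by $\tau_1,\dots,\tau_r$ acts transitively on $[n]$. 4. In particular ($g=0$, the Irving–Rattan theorem), the number of such sequences of length $n+m-2$ is $\frac{(n+m-2)!}{n!}\,\alpha_1\cdots\alpha_m$. -/

import Mathlib

open Equiv

noncomputable section

namespace StarFact

/-- The complex group algebra of the symmetric group on `n` letters. The letters `1, …, n` are the
elements `0, …, n - 1` of `Fin n`. -/
abbrev GroupAlg (n : ℕ) : Type := MonoidAlgebra ℂ (Perm (Fin n))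

/-- Formal linear combinations of formal products `σ₁ ⋯ σ_r` of permutations of `n` letters. -/
abbrev FormalAlg (n : ℕ) : Type := MonoidAlgebra ℂ (FreeMonoid (Perm (Fin n)))

/-- The group generated by the members of the list `l` acts transitively on the letters. -/
def IsTransitive {n : ℕ} (l : List (Perm (Fin n))) : Prop :=
  MulAction.IsPretransitive (Subgroup.closure {σ : Perm (Fin n) | σ ∈ l}) (Fin n)

open Classical in
/-- The linear operator `T`: a formal product `σ₁ ⋯ σ_r` is sent to the permutation
`σ₁ ⋯ σ_r` if `σ₁, …, σ_r` generate a transitive group, and to `0` otherwise. It acts on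
formal products, since transitivity depends on the factors and not only on their product. -/
def T (n : ℕ) : FormalAlg n →ₗ[ℂ] GroupAlg n :=
  Finsupp.linearCombination ℂ
      (fun w : FreeMonoid (Perm (Fin n)) =>
        if IsTransitive w.toList then MonoidAlgebra.of ℂ (Perm (Fin n)) w.toList.prod else 0) ∘ₗ
    (MonoidAlgebra.coeffLinearEquiv ℂ).toLinearMap

/-- The Young-Jucys-Murphy element `X_i`, the sum of the transpositions `(j i)` with `j < i`. -/
def yjm {n : ℕ} (i : Fin n) : GroupAlg n :=
  ∑ j ∈ Finset.Iio i, MonoidAlgebra.of ℂ (Perm (Fin n)) (swap j i)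

/-- `X_i` as a formal sum of formal products of length one. -/
def formalYjm {n : ℕ} (i : Fin n) : FormalAlg n :=
  ∑ j ∈ Finset.Iio i, MonoidAlgebra.of ℂ (FreeMonoid (Perm (Fin n))) (FreeMonoid.of (swap j i))

/-- Multiplying out every formal product turns the formal power into the power `X_i ^ r`. -/
theorem lift_formalYjm_pow {n : ℕ} (i : Fin n) (r : ℕ) :
    MonoidAlgebra.lift ℂ (GroupAlg n) (FreeMonoid (Perm (Fin n)))
      ((MonoidAlgebra.of ℂ (Perm (Fin n))).comp (FreeMonoid.lift id)) (formalYjm i ^ r)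
      = yjm i ^ r := by
  simp [formalYjm, yjm]

/-- The transitive power `T X_n ^ r`; the letter `n` is the last element of `Fin n`. -/
def transPow (n : ℕ) (hn : 1 ≤ n) (r : ℕ) : GroupAlg n :=
  T n (formalYjm (⟨n - 1, by omega⟩ : Fin n) ^ r)

/-- The sum `K_α` of all permutations whose cycle lengths (fixed points included) are the parts
of `α`. -/
def classSum {n : ℕ} (α : n.Partition) : GroupAlg n :=
  ∑ σ : Perm (Fin n) with σ.partition.parts = α.parts, MonoidAlgebra.of ℂ (Perm (Fin n)) σ

/-- The power series `2 sinh (x / 2) = exp (x / 2) - exp (- x / 2)`. -/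
def twoSinhHalf : PowerSeries ℚ :=
  PowerSeries.rescale (1 / 2 : ℚ) (PowerSeries.exp ℚ)
    - PowerSeries.rescale (-1 / 2 : ℚ) (PowerSeries.exp ℚ)

/-- The power series `2 x⁻¹ sinh (x / 2)`. -/
def xiSeries : PowerSeries ℚ :=
  PowerSeries.mk fun k => PowerSeries.coeff (k + 1) twoSinhHalf

/-- `ξ_k`, the coefficient of `x ^ k` in `log (2 x⁻¹ sinh (x / 2))`. -/
def xi (k : ℕ) : ℚ := PowerSeries.coeff k (PowerSeries.logOf xiSeries)

/-- The power sum `p_i` of the parts of `s`. -/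
def p (i : ℕ) (s : Multiset ℕ) : ℚ := (s.map fun a => (a : ℚ) ^ i).sum

/-- `q_i = p_i + p_1 - 2`. -/
def q (i : ℕ) (s : Multiset ℕ) : ℚ := p i s + p 1 s - 2

/-- `|Aut β|`, the product of the factorials of the multiplicities of the parts. -/
def autCard (b : Multiset ℕ) : ℕ := ∏ j ∈ b.toFinset, (b.count j).factorial

/-- `Q_g`, the sum over the partitions `β` of `g` of `ξ_{2β} q_{2β} / |Aut β|`. -/
def Q (g : ℕ) (s : Multiset ℕ) : ℚ :=
  ∑ β : g.Partition,
    (β.parts.map fun j => xi (2 * j)).prod * (β.parts.map fun j => q (2 * j) s).prod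
      / (autCard β.parts : ℚ)

/-- The star factorization number `a_g(α)`, where `s` is the multiset of parts of `α`; thus
`n = s.sum` and `m = s.card`. For `s` nonempty with positive entries `n + m ≥ 2`, so the
subtraction is the true one. -/
def a (g : ℕ) (s : Multiset ℕ) : ℚ :=
  ((s.sum + s.card - 2 + 2 * g).factorial : ℚ) / (s.sum.factorial : ℚ) * (s.prod : ℚ) * Q g s

/-- The (finite) set of transitive factorizations `(τ₁, …, τ_r)` of `σ` into `r` star
transpositions `(i c)` with pivot `i`. -/
def starFactorizations {n : ℕ} (i : Fin n) (r : ℕ) (σ : Perm (Fin n)) :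
    Set (List (Perm (Fin n))) :=
  {l | l.length = r ∧ (∀ τ ∈ l, ∃ c : Fin n, c ≠ i ∧ τ = swap i c) ∧ l.prod = σ ∧
    IsTransitive l}

end StarFact

end

/-!
Write `s(x) = 2 sinh (x / 2)`. For a permutation `σ` with cycle lengths `α = (α₁, …, α_m) ⊢ n`,
the exponential generating function by length of the transitive star factorizations of `σ` is

  `H_α(x) = s(x) ^ (n - 2) * ∏ s(α_i x) / n!`   (`starSeries`).

A word in the star transpositions `(i c)` generates a transitive group if and only if every letter
`c ≠ i` occurs in it (`isTransitive_iff`). For a set `T` of letters that contains `i`, consider the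
words with set of letters exactly `T \ {i}` and with product `σ`, a permutation of `T`. Removing the
first factor `(i j)` leaves a word with product `(i j) σ`, whose set of letters is again `T \ {i}`,
or is `T \ {i, j}` (`card_starWords_succ`). In the first case `(i j)` cuts the cycle of `i` in two
or joins it to another cycle. In the second case `j` must be a fixed point of `(i j) σ`, hence
`σ j = i`, and the effect is that `j` is removed from the cycle of `i`. If that cycle has length
`l + 1` and the other cycles have the lengths `s`, this is the system of differential equations

  `H_{l+1, s}' = ∑_{a ∈ s} a H_{l+1+a, s - a} + ∑_{k < l} H_{k+1, l-k, s} + [l ≠ 0] H_{l, s}`,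

which the closed form satisfies by the addition theorems for `sinh` and a telescoping sum
(`derivative_starSeries`). Comparison of coefficients and induction on the length of the word
identify the numbers of words with the coefficients of `H` (`card_starWords`).

To pass from `H_α` to `a_g(α)`, put `ξ(x) = s(x) / x`. Then
`H_α = (α₁ ⋯ α_m / n!) x ^ (n + m - 2) ξ(x) ^ (n - 2) ∏ ξ(α_i x)`, and the last two factors
multiply to `∑_g Q_g(α) x ^ (2 g)` because both sides have the logarithmic derivative
`∑ k ξ_k q_k x ^ (k - 1)` (`expand_mk_Q`); on the side of the `Q_g` this is the recursion that comes
from removing a marked part of a partition (`mul_partSum`). The numbers so obtained depend on the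
cycle type only, whence the centrality of the transitive powers.
-/

noncomputable section

namespace StarFact

open PowerSeries

/-! ### Hyperbolic sines as power series and the differential equations -/

/-- The power series `exp (t x)`. -/
def expS (t : ℚ) : PowerSeries ℚ := rescale t (exp ℚ)

theorem expS_mul (a b : ℚ) : expS a * expS b = expS (a + b) := exp_mul_exp_eq_exp_add a b

theorem derivative_rescale (t : ℚ) (f : PowerSeries ℚ) :
    derivative ℚ (rescale t f) = C t * rescale t (derivative ℚ f) := by
  ext k
  simp only [coeff_derivative, coeff_rescale, coeff_C_mul]
  ring

theorem derivative_expS (t : ℚ) : derivative ℚ (expS t) = C t * expS t := by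
  rw [expS, derivative_rescale, derivative_exp]

/-- The power series `2 sinh (a x / 2)`. -/
def sh (a : ℕ) : PowerSeries ℚ := expS (a / 2) - expS (-a / 2)

/-- The power series `2 cosh (a x / 2)`. -/
def ch (a : ℕ) : PowerSeries ℚ := expS (a / 2) + expS (-a / 2)

theorem sh_zero : sh 0 = 0 := by simp [sh]

theorem derivative_sh (a : ℕ) : derivative ℚ (sh a) = C (a / 2 : ℚ) * ch a := by
  rw [sh, ch, map_sub, derivative_expS, derivative_expS, neg_div, map_neg]
  ring

theorem two_mul_sh (l : ℕ) : 2 * sh l = sh (l + 1) * ch 1 - ch (l + 1) * sh 1 := by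
  simp only [sh, ch, mul_sub, mul_add, sub_mul, add_mul, expS_mul]
  push_cast
  ring_nf

theorem two_mul_sh_add (a b : ℕ) : 2 * sh (a + b) = sh a * ch b + ch a * sh b := by
  simp only [sh, ch, mul_sub, mul_add, sub_mul, add_mul, expS_mul]
  push_cast
  ring_nf

/-- The sum over the ways to cut a cycle of length `l + 1` in two. -/
theorem sh_one_mul_sum_sh_mul_sh (l : ℕ) :
    sh 1 * ∑ j ∈ Finset.range l, sh (j + 1) * sh (l - j) = l * (sh 1 * ch (l + 1)) - 2 * sh l := by
  -- By the addition theorem `sh (j + 1) * sh (l - j)` is `ch (l + 1)` minus two exponentials;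
  -- after multiplication with `sh 1` these form telescoping sums.
  have h1 : ∑ j ∈ Finset.range l, sh 1 * expS ((2 * j + 1 - l) / 2) = sh l := by
    rw [Finset.sum_congr rfl (g := fun j : ℕ => expS ((2 * (j + 1 : ℕ) - l) / 2)
      - expS ((2 * j - l) / 2)), Finset.sum_range_sub (fun j : ℕ => expS ((2 * j - l) / 2)), sh]
    · push_cast; ring_nf
    · intro j _
      simp only [sh, sub_mul, expS_mul]
      push_cast; ring_nf
  have h2 : ∑ j ∈ Finset.range l, sh 1 * expS (-(2 * j + 1 - l) / 2) = sh l := by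
    rw [Finset.sum_congr rfl (g := fun j : ℕ => expS ((l - 2 * j) / 2)
      - expS ((l - 2 * (j + 1 : ℕ)) / 2)),
      Finset.sum_range_sub' (fun j : ℕ => expS ((l - 2 * j) / 2)), sh]
    · push_cast; ring_nf
    · intro j _
      simp only [sh, sub_mul, expS_mul]
      push_cast; ring_nf
  have h3 : ∑ j ∈ Finset.range l, sh 1 * (sh (j + 1) * sh (l - j)) =
      ∑ j ∈ Finset.range l, (sh 1 * ch (l + 1) - sh 1 * expS ((2 * j + 1 - l) / 2)
        - sh 1 * expS (-(2 * j + 1 - l) / 2)) := by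
    refine Finset.sum_congr rfl fun j hj => ?_
    have : ((l - j : ℕ) : ℚ) = l - j := Nat.cast_sub (Finset.mem_range.1 hj).le
    rw [sub_sub, ← mul_add, ← mul_sub]
    congr 1
    simp only [sh, ch, sub_mul, mul_sub, expS_mul, this]
    push_cast; ring_nf
  rw [Finset.mul_sum, h3, Finset.sum_sub_distrib, Finset.sum_sub_distrib, h1, h2]
  simp
  ring

theorem twoSinhHalf_eq : twoSinhHalf = sh 1 := by
  simp [twoSinhHalf, sh, expS]

theorem rescale_sh_one (a : ℕ) : rescale (a : ℚ) (sh 1) = sh a := by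
  simp only [sh, expS, map_sub, rescale_rescale]
  ring_nf

theorem sh_one_eq : sh 1 = X * xiSeries := by
  rw [← twoSinhHalf_eq]
  ext k
  cases k with
  | zero => simp only [twoSinhHalf, map_sub, coeff_rescale, coeff_zero_X_mul]; simp
  | succ k => rw [coeff_succ_X_mul, xiSeries, coeff_mk]

theorem sh_eq (a : ℕ) : sh a = X * (C (a : ℚ) * rescale (a : ℚ) xiSeries) := by
  rw [← rescale_sh_one, sh_one_eq, map_mul, rescale_X]
  ring

theorem constantCoeff_xiSeries : constantCoeff xiSeries = 1 := by
  rw [← coeff_zero_eq_constantCoeff_apply, xiSeries, coeff_mk, twoSinhHalf]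
  simp [coeff_rescale, coeff_exp]
  norm_num

theorem xiSeries_mul_inv : xiSeries * xiSeries⁻¹ = 1 :=
  PowerSeries.mul_inv_cancel _ (by simp [constantCoeff_xiSeries])

theorem sh_one_ne_zero : sh 1 ≠ 0 := by
  rw [sh_one_eq]
  refine mul_ne_zero X_ne_zero fun h => ?_
  have := constantCoeff_xiSeries
  simp [h] at this

/-- The quotient `sinh (a x / 2) / sinh (x / 2)`. -/
def shQuot (a : ℕ) : PowerSeries ℚ := C (a : ℚ) * (rescale (a : ℚ) xiSeries * xiSeries⁻¹)

theorem sh_one_mul_shQuot (a : ℕ) : sh 1 * shQuot a = sh a := by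
  rw [sh_eq a, sh_one_eq, shQuot]
  linear_combination (X * (C (a : ℚ) * rescale (a : ℚ) xiSeries)) * xiSeries_mul_inv

theorem shQuot_one : shQuot 1 = 1 := by
  simp [shQuot, xiSeries_mul_inv]

/-- The exponential generating function, by length, of the transitive star factorizations of a
permutation whose cycle lengths are the members of `s`: with `n` the sum and `m` the number of
the members, it is `(2 sinh (x / 2)) ^ (n - 2) * ∏ 2 sinh (a x / 2) / n!`. Each factor
`2 sinh (a x / 2)` has been divided by `2 sinh (x / 2)`, so that the exponent becomes
`n + m - 2`, which is a natural number. -/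
def starSeries (s : Multiset ℕ) : PowerSeries ℚ :=
  C ((s.sum.factorial : ℚ)⁻¹) * (sh 1 ^ (s.sum + s.card - 2) * (s.map shQuot).prod)

/-- The definition of `starSeries` with its denominators cleared. -/
theorem starSeries_spec (s : Multiset ℕ) (h : 1 ≤ s.sum) (h' : 1 ≤ s.card) :
    C (s.sum.factorial : ℚ) * (sh 1 ^ 2 * starSeries s) = sh 1 ^ s.sum * (s.map sh).prod := by
  have h1 : (s.map sh).prod = sh 1 ^ s.card * (s.map shQuot).prod := by
    rw [← Multiset.prod_replicate, ← Multiset.map_const', ← Multiset.prod_map_mul]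
    simp [sh_one_mul_shQuot]
  have h2 : C (s.sum.factorial : ℚ) * C ((s.sum.factorial : ℚ)⁻¹) = (1 : PowerSeries ℚ) := by
    rw [← map_mul, mul_inv_cancel₀ (by positivity), map_one]
  have h3 : s.sum + s.card = (s.sum + s.card - 2) + 2 := by omega
  rw [h1, ← mul_assoc (sh 1 ^ _) (sh 1 ^ _), ← pow_add, h3, pow_add, starSeries]
  linear_combination (sh 1 ^ 2 * (sh 1 ^ (s.sum + s.card - 2) * (s.map shQuot).prod)) * h2

/-- Leibniz' rule for `∏ 2 sinh (a x / 2)`. -/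
theorem derivative_prod_sh (s : Multiset ℕ) :
    derivative ℚ (s.map sh).prod =
      (s.map fun a : ℕ => C (a / 2 : ℚ) * (ch a * ((s.erase a).map sh).prod)).sum := by
  induction s using Multiset.induction_on with
  | empty => simp
  | cons b s ih =>
    have h : (s.map fun a : ℕ => C (a / 2 : ℚ) * (ch a * (((b ::ₘ s).erase a).map sh).prod)) =
        s.map fun a : ℕ => sh b * (C (a / 2 : ℚ) * (ch a * ((s.erase a).map sh).prod)) := by
      refine Multiset.map_congr rfl fun a ha => ?_
      rw [Multiset.erase_cons_tail_of_mem ha, Multiset.map_cons, Multiset.prod_cons]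
      ring
    rw [Multiset.map_cons, Multiset.prod_cons, Derivation.leibniz, ih, derivative_sh,
      Multiset.map_cons, Multiset.sum_cons, h, Multiset.sum_map_mul_left, Multiset.erase_cons_head]
    simp only [smul_eq_mul]
    ring

/-- The system of differential equations for `starSeries`: the three kinds of terms come from a
transposition that joins the pivot's cycle, of length `l + 1`, to another cycle, from one that
cuts it in two, and from one that removes a letter of that cycle for good. -/
theorem derivative_starSeries (l : ℕ) (s : Multiset ℕ) :
    derivative ℚ (starSeries ((l + 1) ::ₘ s)) =
      (s.map fun a => a • starSeries ((l + 1 + a) ::ₘ s.erase a)).sum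
      + ∑ j ∈ Finset.range l, starSeries ((j + 1) ::ₘ (l - j) ::ₘ s)
      + if l = 0 then 0 else starSeries (l ::ₘ s) := by
  set n := l + 1 + s.sum with hn
  set M := (s.map sh).prod with hM
  -- Multiplying with `n! (2 sinh (x / 2)) ^ 3` clears all denominators, so that `starSeries_spec`
  -- applies to every term.
  have hne : C (n.factorial : ℚ) * sh 1 ^ 3 ≠ 0 :=
    mul_ne_zero (by rw [Ne, map_eq_zero_iff _ C_injective]; positivity)
      (pow_ne_zero _ sh_one_ne_zero)
  apply mul_left_cancel₀ hne
  have key := starSeries_spec ((l + 1) ::ₘ s) (by simp; omega) (by simp)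
  have dkey := congrArg (derivative ℚ) key
  simp only [Multiset.sum_cons, Multiset.map_cons, Multiset.prod_cons, Derivation.leibniz,
    ← hn, ← hM, smul_eq_mul, derivative_C, derivative_sh, derivative_pow] at key dkey
  have merge : C (n.factorial : ℚ) * sh 1 ^ 3 *
        (s.map fun a => a • starSeries ((l + 1 + a) ::ₘ s.erase a)).sum =
      sh 1 ^ n * sh 1 * (sh (l + 1) * derivative ℚ M
        + C (s.sum / 2 : ℚ) * (ch (l + 1) * M)) := by
    have hsum : (s.map fun a : ℕ => C (a / 2 : ℚ) * (ch (l + 1) * M)).sum =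
        C (s.sum / 2 : ℚ) * (ch (l + 1) * M) := by
      rw [Multiset.sum_map_mul_right]
      congr 1
      have : ∀ a : ℕ, (C (a / 2 : ℚ) : PowerSeries ℚ) = C (1 / 2 : ℚ) * a := by
        intro a
        rw [← map_natCast C a, ← map_mul]
        congr 1
        ring
      simp only [this]
      rw [Multiset.sum_map_mul_left, Nat.cast_multiset_sum]
    rw [hM, derivative_prod_sh, ← hM, ← hsum, ← Multiset.sum_map_mul_left,
      ← Multiset.sum_map_mul_left, ← Multiset.sum_map_add, ← Multiset.sum_map_mul_left]
    refine congrArg _ (Multiset.map_congr rfl fun a ha => ?_)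
    have hs : a + (s.erase a).sum = s.sum := by
      rw [← Multiset.sum_cons, Multiset.cons_erase ha]
    have hp : sh a * ((s.erase a).map sh).prod = M := by
      rw [hM, ← Multiset.prod_cons, ← Multiset.map_cons, Multiset.cons_erase ha]
    have h := starSeries_spec ((l + 1 + a) ::ₘ s.erase a) (by simp; omega) (by simp)
    simp only [Multiset.sum_cons, Multiset.map_cons, Multiset.prod_cons] at h
    rw [show l + 1 + a + (s.erase a).sum = n by omega] at h
    have ha2 : (a : PowerSeries ℚ) = 2 * C (a / 2 : ℚ) := by
      rw [← map_ofNat C 2, ← map_mul, mul_div_cancel₀ _ two_ne_zero, map_natCast]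
    rw [nsmul_eq_mul, ha2]
    linear_combination 2 * C (a / 2 : ℚ) * sh 1 * h
      + C (a / 2 : ℚ) * sh 1 * sh 1 ^ n * ((s.erase a).map sh).prod * two_mul_sh_add (l + 1) a
      + C (a / 2 : ℚ) * sh 1 * sh 1 ^ n * ch (l + 1) * hp
  have split : C (n.factorial : ℚ) * sh 1 ^ 3 *
        ∑ j ∈ Finset.range l, starSeries ((j + 1) ::ₘ (l - j) ::ₘ s) =
      sh 1 ^ n * M * (l * (sh 1 * ch (l + 1)) - 2 * sh l) := by
    rw [← sh_one_mul_sum_sh_mul_sh, Finset.mul_sum, Finset.mul_sum, Finset.mul_sum]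
    refine Finset.sum_congr rfl fun j hj => ?_
    have hj := Finset.mem_range.1 hj
    have h := starSeries_spec ((j + 1) ::ₘ (l - j) ::ₘ s) (by simp; omega) (by simp)
    simp only [Multiset.sum_cons, Multiset.map_cons, Multiset.prod_cons] at h
    rw [show j + 1 + (l - j + s.sum) = n by omega] at h
    linear_combination sh 1 * h
  have drop : C (n.factorial : ℚ) * sh 1 ^ 3 * (if l = 0 then 0 else starSeries (l ::ₘ s)) =
      C (n : ℚ) * sh 1 ^ n * sh l * M := by
    split_ifs with hl
    · simp [hl, sh_zero]
    · have h := starSeries_spec (l ::ₘ s) (by simp; omega) (by simp)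
      simp only [Multiset.sum_cons, Multiset.map_cons, Multiset.prod_cons] at h
      have hn' : n = l + s.sum + 1 := by omega
      rw [hn', Nat.factorial_succ, Nat.cast_mul, map_mul]
      linear_combination C ((l + s.sum + 1 : ℕ) : ℚ) * sh 1 * h
  rw [mul_add, mul_add, merge, split, drop]
  have hpow : sh 1 ^ n = sh 1 * sh 1 ^ (n - 1) := by
    rw [← pow_succ']
    congr 1
    omega
  have hC : (C (1 / 2 : ℚ) : PowerSeries ℚ) * 2 = 1 := by
    rw [← map_ofNat C 2, ← map_mul]
    norm_num
  have hC1 : ∀ k : ℕ, (C (k / 2 : ℚ) : PowerSeries ℚ) = C (1 / 2 : ℚ) * k := by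
    intro k
    rw [← map_natCast C k, ← map_mul]
    congr 1
    ring
  have hn' : (n : PowerSeries ℚ) = l + 1 + s.sum := by rw [hn]; push_cast; ring
  have hCn : (C (n : ℚ) : PowerSeries ℚ) = n := by simp
  have hC2 : (C ((l + 1) / 2 : ℚ) : PowerSeries ℚ) = C (1 / 2 : ℚ) * (l + 1) := by
    exact_mod_cast hC1 (l + 1)
  simp only [hC1, hC2, hCn, hn', Nat.cast_add, Nat.cast_one] at dkey ⊢
  linear_combination sh 1 * dkey - 2 * C (1 / 2 : ℚ) * ch 1 * key
    - sh (l + 1) * M * (l + 1 + s.sum) * C (1 / 2 : ℚ) * ch 1 * hpow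
    + ((l + s.sum - 1) * sh 1 ^ n * M * sh l + l * sh 1 ^ n * sh 1 * M * ch (l + 1)) * hC
    - C (1 / 2 : ℚ) * (l + s.sum - 1) * sh 1 ^ n * M * two_mul_sh l

/-! ### The exponential formula over partitions -/

theorem autCard_eq_prod (b : Multiset ℕ) (t : Finset ℕ) (h : b.toFinset ⊆ t) :
    autCard b = ∏ j ∈ t, (b.count j).factorial :=
  Finset.prod_subset h fun j _ hj => by
    rw [Multiset.count_eq_zero_of_notMem (by simpa using hj), Nat.factorial_zero]

theorem autCard_cons (j : ℕ) (b : Multiset ℕ) :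
    autCard (j ::ₘ b) = (b.count j + 1) * autCard b := by
  have hj : j ∈ insert j b.toFinset := Finset.mem_insert_self _ _
  rw [autCard_eq_prod (j ::ₘ b) (insert j b.toFinset) (by simp),
    autCard_eq_prod b (insert j b.toFinset) (Finset.subset_insert _ _),
    ← Finset.mul_prod_erase _ _ hj, ← Finset.mul_prod_erase _ _ hj, Multiset.count_cons_self,
    Nat.factorial_succ, mul_assoc]
  congr 2
  refine Finset.prod_congr rfl fun k hk => ?_
  rw [Multiset.count_cons_of_ne (Finset.ne_of_mem_erase hk)]

/-- The weight `∏ y_{β_i} / |Aut β|` of the multiset `β`. -/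
def partWeight (y : ℕ → ℚ) (b : Multiset ℕ) : ℚ := (b.map y).prod / (autCard b : ℚ)

/-- The sum of the weights of the partitions of `g`. -/
def partSum (y : ℕ → ℚ) (g : ℕ) : ℚ := ∑ β : g.Partition, partWeight y β.parts

theorem count_mul_partWeight_cons (y : ℕ → ℚ) (j : ℕ) (b : Multiset ℕ) :
    ((j ::ₘ b).count j : ℚ) * partWeight y (j ::ₘ b) = y j * partWeight y b := by
  have h : (autCard b : ℚ) ≠ 0 := by
    simp [autCard, Finset.prod_ne_zero_iff, Nat.factorial_ne_zero]
  rw [partWeight, partWeight, autCard_cons, Multiset.map_cons, Multiset.prod_cons,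
    Multiset.count_cons_self]
  push_cast
  field_simp

theorem partSum_zero (y : ℕ → ℚ) : partSum y 0 = 1 := by
  simp [partSum, partWeight, autCard, Nat.Partition.partition_zero_parts]

/-- Removing a marked part from a partition: the coefficient form of `E' = Y' E` for
`E = exp Y`. -/
theorem mul_partSum (y : ℕ → ℚ) (g : ℕ) :
    g * partSum y g = ∑ j ∈ Finset.Icc 1 g, j * y j * partSum y (g - j) := by
  have h1 : ∀ β : g.Partition, (g : ℚ) * partWeight y β.parts =
      ∑ j ∈ Finset.Icc 1 g with j ∈ β.parts, j * (β.parts.count j * partWeight y β.parts) := by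
    intro β
    have h2 : (g : ℚ) = ∑ j ∈ Finset.Icc 1 g with j ∈ β.parts, (j * β.parts.count j : ℚ) := by
      have h3 : (Finset.Icc 1 g).filter (· ∈ β.parts) = β.parts.toFinset := by
        ext j
        simp only [Finset.mem_filter, Finset.mem_Icc, Multiset.mem_toFinset, and_iff_right_iff_imp]
        exact fun hj => ⟨β.parts_pos hj, (Multiset.le_sum_of_mem hj).trans_eq β.parts_sum⟩
      rw [h3]
      conv_lhs => rw [← β.parts_sum, ← Multiset.map_id β.parts, Finset.sum_multiset_map_count]
      push_cast
      exact Finset.sum_congr rfl fun j _ => by simp [mul_comm]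
    conv_lhs => rw [h2, Finset.sum_mul]
    exact Finset.sum_congr rfl fun j _ => by ring
  rw [partSum, Finset.mul_sum, Finset.sum_congr rfl fun β _ => h1 β,
    Finset.sum_comm' (t' := Finset.Icc 1 g)
      (s' := fun j => Finset.univ.filter fun β : g.Partition => j ∈ β.parts) (by simp; tauto)]
  refine Finset.sum_congr rfl fun j hj => ?_
  obtain ⟨hj1, hjg⟩ := Finset.mem_Icc.1 hj
  rw [partSum, Finset.mul_sum]
  refine Finset.sum_bij'
    (fun β hβ => ⟨β.parts.erase j, fun h => β.parts_pos (Multiset.mem_of_mem_erase h), by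
      have h := congrArg Multiset.sum (Multiset.cons_erase (Finset.mem_filter.1 hβ).2)
      rw [Multiset.sum_cons, β.parts_sum] at h
      omega⟩)
    (fun β _ => ⟨j ::ₘ β.parts, by
      intro i hi
      rcases Multiset.mem_cons.1 hi with rfl | hi
      exacts [hj1, β.parts_pos hi], by
      rw [Multiset.sum_cons, β.parts_sum]; omega⟩)
    ?_ ?_ ?_ ?_ ?_
  · simp
  · simp
  · intro β hβ
    ext1
    exact Multiset.cons_erase (Finset.mem_filter.1 hβ).2
  · intro β hβ
    ext1
    simp
  · intro β hβ
    have h := count_mul_partWeight_cons y j (β.parts.erase j)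
    rw [Multiset.cons_erase (Finset.mem_filter.1 hβ).2] at h
    rw [h, mul_assoc]

theorem Q_eq_partSum (g : ℕ) (s : Multiset ℕ) :
    Q g s = partSum (fun j => xi (2 * j) * q (2 * j) s) g := by
  simp only [Q, partSum, partWeight, Multiset.prod_map_mul]

/-- The series `E = ∑ partSum y g x ^ g` satisfies `E' = E Y'` for `Y = ∑ y_g x ^ g`. -/
theorem derivative_mk_partSum (y : ℕ → ℚ) :
    derivative ℚ (mk (partSum y)) = mk (partSum y) * derivative ℚ (mk y) := by
  ext g
  rw [coeff_derivative, coeff_mk, mul_comm (mk _), coeff_mul,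
    Finset.Nat.sum_antidiagonal_eq_sum_range_succ_mk]
  have h := mul_partSum y (g + 1)
  push_cast at h
  rw [mul_comm, h]
  refine Finset.sum_nbij' (· - 1) (· + 1) ?_ ?_ ?_ ?_ fun j hj => ?_
  · simp
  · simp
  · simp +contextual
  · simp
  · obtain ⟨j, rfl⟩ := Nat.exists_eq_add_of_le' (Finset.mem_Icc.1 hj).1
    simp only [coeff_derivative, coeff_mk, Nat.add_sub_cancel, Nat.add_sub_add_right]
    push_cast
    ring

/-! ### Logarithmic derivatives -/

/-- The logarithmic derivative of `f` is the derivative of `logOf f`. -/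
theorem derivative_logOf (f : PowerSeries ℚ) (hf : constantCoeff f = 1) :
    f * derivative ℚ (logOf f) = derivative ℚ f := by
  have hs : HasSubst (f - 1) := HasSubst.of_constantCoeff_zero' (by simp [hf])
  have h1 : (1 + X) * derivative ℚ (log ℚ) = 1 := by
    rw [deriv_log]
    ext k
    cases k with
    | zero => simp
    | succ k => simp [add_mul, coeff_succ_X_mul, pow_succ, coeff_one]
  have h2 := congrArg (subst (f - 1)) h1
  rw [subst_mul hs, subst_add hs, subst_X hs, ← coe_substAlgHom hs, map_one,
    coe_substAlgHom] at h2
  rw [logOf_eq, derivative_subst hs, map_sub, derivative_one]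
  linear_combination derivative ℚ f * h2

theorem constantCoeff_rescale (t : ℚ) (f : PowerSeries ℚ) :
    constantCoeff (rescale t f) = constantCoeff f := by
  rw [← coeff_zero_eq_constantCoeff_apply, ← coeff_zero_eq_constantCoeff_apply, coeff_rescale,
    pow_zero, one_mul]

theorem eq_of_derivative_eq_mul {f h y : PowerSeries ℚ} (hf : derivative ℚ f = f * y)
    (hh : derivative ℚ h = h * y) (hf0 : constantCoeff f = 1) (hh0 : constantCoeff h = 1) :
    f = h := by
  have hi : f * f⁻¹ = 1 := PowerSeries.mul_inv_cancel _ (by simp [hf0])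
  have hd : h * f⁻¹ = 1 := by
    refine derivative.ext ?_ (by simp [hf0, hh0])
    rw [Derivation.leibniz, derivative_inv', derivative_one, hf, hh, smul_eq_mul, smul_eq_mul]
    linear_combination (-f⁻¹ * h * y) * hi
  linear_combination (-f) * hd + h * hi

theorem derivative_expand_two (f : PowerSeries ℚ) :
    derivative ℚ (expand 2 two_ne_zero f) =
      expand 2 two_ne_zero (derivative ℚ f) * derivative ℚ (X ^ 2) := by
  rw [expand_apply, expand_apply, derivative_subst (HasSubst.X_pow two_ne_zero)]

/-- The series `log (2 x⁻¹ sinh (x / 2))` is even. -/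
theorem xi_odd (k : ℕ) : xi (2 * k + 1) = 0 := by
  have h1 : rescale (-1) xiSeries = xiSeries := by
    have h : rescale (-1) (sh 1) = - sh 1 := by
      simp only [sh, expS, map_sub, rescale_rescale]
      ring_nf
    rw [sh_one_eq, map_mul, rescale_neg_one_X, neg_mul, neg_inj] at h
    exact mul_left_cancel₀ X_ne_zero h
  have h2 := derivative_logOf _ constantCoeff_xiSeries
  have h3 : rescale (-1) (derivative ℚ xiSeries) = - derivative ℚ xiSeries := by
    have h := derivative_rescale (-1) xiSeries
    rw [h1, map_neg, map_one] at h
    linear_combination h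
  have h4 := congrArg (rescale (-1 : ℚ)) h2
  rw [map_mul, h1, h3, ← h2, ← mul_neg] at h4
  have h5 := mul_left_cancel₀ (fun h => by simpa [h] using constantCoeff_xiSeries) h4
  have h6 := congrArg (coeff (2 * k)) h5
  rw [coeff_rescale, map_neg, coeff_derivative] at h6
  simp only [even_two, Even.mul_right, Even.neg_pow, one_pow, one_mul] at h6
  have h7 : coeff (2 * k + 1) (logOf xiSeries) * (((2 * k : ℕ) : ℚ) + 1) = 0 := by linarith
  exact (mul_eq_zero.1 h7).resolve_right (by positivity)

/-- In the definition of `p` the coercion to `ℚ` is applied to the multiset `s`, not to its members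
one by one. -/
theorem p_eq (i : ℕ) (s : Multiset ℕ) : p i s = (s.map fun a : ℕ => (a : ℚ) ^ i).sum := by
  simp [p, Multiset.bind_def, Multiset.pure_def]

/-- The generating function `∑ Q_g x ^ (2 g)`, in closed form. Both sides have the logarithmic
derivative `∑ k ξ_k q_k x ^ (k - 1)`. -/
theorem expand_mk_Q (s : Multiset ℕ) (h : 2 ≤ s.sum + s.card) :
    expand 2 two_ne_zero (mk fun g => Q g s) =
      xiSeries ^ (s.sum + s.card - 2) *
        (s.map fun a : ℕ => rescale (a : ℚ) xiSeries * xiSeries⁻¹).prod := by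
  set L := logOf xiSeries with hL
  have hx : derivative ℚ xiSeries = xiSeries * derivative ℚ L :=
    (derivative_logOf _ constantCoeff_xiSeries).symm
  have hfac (a : ℕ) : derivative ℚ (rescale (a : ℚ) xiSeries * xiSeries⁻¹) =
      rescale (a : ℚ) xiSeries * xiSeries⁻¹ * derivative ℚ (rescale (a : ℚ) L - L) := by
    rw [Derivation.leibniz, derivative_rescale, derivative_inv', map_sub, derivative_rescale, hx,
      map_mul, smul_eq_mul, smul_eq_mul]
    linear_combination (-xiSeries⁻¹ * rescale (a : ℚ) xiSeries * derivative ℚ L) * xiSeries_mul_inv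
  have hprod (t : Multiset ℕ) :
      derivative ℚ (t.map fun a : ℕ => rescale (a : ℚ) xiSeries * xiSeries⁻¹).prod =
      (t.map fun a : ℕ => rescale (a : ℚ) xiSeries * xiSeries⁻¹).prod *
        derivative ℚ (t.map fun a : ℕ => rescale (a : ℚ) L - L).sum := by
    induction t using Multiset.induction_on with
    | empty => simp
    | cons a t ih =>
      rw [Multiset.map_cons, Multiset.prod_cons, Derivation.leibniz, ih, hfac, Multiset.map_cons,
        Multiset.sum_cons, map_add, smul_eq_mul, smul_eq_mul]
      ring
  -- Both sides have the coefficients `ξ_k q_k`; the left side lists those of even index, and the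
  -- others vanish.
  have hY : expand 2 two_ne_zero (mk fun j => xi (2 * j) * q (2 * j) s) =
      ((s.sum + s.card - 2 : ℕ) : PowerSeries ℚ) * L
        + (s.map fun a : ℕ => rescale (a : ℚ) L - L).sum := by
    ext k
    have h1 : ((s.sum + s.card - 2 : ℕ) : ℚ) = s.sum + s.card - 2 := by
      rw [Nat.cast_sub h]; push_cast; ring
    have h2 : xi k * q k s = coeff k (((s.sum + s.card - 2 : ℕ) : PowerSeries ℚ) * L
        + (s.map fun a : ℕ => rescale (a : ℚ) L - L).sum) := by
      rw [map_add, ← map_natCast C, coeff_C_mul, map_multiset_sum, Multiset.map_map, h1]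
      simp only [Function.comp_def, map_sub, coeff_rescale, Multiset.sum_map_sub,
        Multiset.sum_map_mul_right, Multiset.map_const', Multiset.sum_replicate, nsmul_eq_mul]
      rw [q, p_eq, p_eq, xi, ← hL]
      simp only [pow_one, Nat.cast_multiset_sum]
      ring
    rw [← h2, coeff_expand]
    split_ifs with hk
    · obtain ⟨j, rfl⟩ := hk
      simp
    · obtain ⟨j, rfl⟩ := Nat.odd_iff.2 (Nat.two_dvd_ne_zero.1 hk)
      rw [xi_odd, zero_mul]
  refine eq_of_derivative_eq_mul (y := derivative ℚ
    (expand 2 two_ne_zero (mk fun j => xi (2 * j) * q (2 * j) s))) ?_ ?_ ?_ ?_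
  · have hQ : (mk fun g => Q g s) = mk (partSum fun j => xi (2 * j) * q (2 * j) s) := by
      ext g
      simp [Q_eq_partSum]
    rw [hQ, derivative_expand_two, derivative_mk_partSum, map_mul, derivative_expand_two]
    ring
  · rw [hY, Derivation.leibniz, hprod, derivative_pow, hx, map_add, Derivation.leibniz,
      Derivation.map_natCast, smul_eq_mul, smul_eq_mul, smul_eq_mul, smul_eq_mul]
    cases s.sum + s.card - 2 with
    | zero => simp
    | succ e =>
      rw [Nat.add_sub_cancel]
      ring
  · rw [constantCoeff_expand, ← coeff_zero_eq_constantCoeff_apply, coeff_mk, Q_eq_partSum,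
      partSum_zero]
  · rw [map_mul, map_pow, constantCoeff_xiSeries, one_pow, one_mul, map_multiset_prod,
      Multiset.map_map]
    refine Multiset.prod_eq_one fun x hx => ?_
    obtain ⟨a, -, rfl⟩ := Multiset.mem_map.1 hx
    simp [constantCoeff_rescale, constantCoeff_xiSeries]

/-- `starSeries` as the generating function of the numbers `Q_g`. -/
theorem starSeries_eq (s : Multiset ℕ) (h : 2 ≤ s.sum + s.card) :
    starSeries s = C ((s.sum.factorial : ℚ)⁻¹ * s.prod) *
      (X ^ (s.sum + s.card - 2) * expand 2 two_ne_zero (mk fun g => Q g s)) := by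
  have h1 : (s.map fun a => shQuot a).prod = C (s.prod : ℚ) *
      (s.map fun a : ℕ => rescale (a : ℚ) xiSeries * xiSeries⁻¹).prod := by
    simp only [shQuot, Multiset.prod_map_mul]
    rw [Nat.cast_multiset_prod, map_multiset_prod, Multiset.map_map]
    rfl
  rw [starSeries, show s.map shQuot = s.map fun a => shQuot a from rfl, h1, sh_one_eq,
    mul_pow, expand_mk_Q s h, map_mul]
  ring

theorem factorial_mul_coeff_starSeries (s : Multiset ℕ) (h : 2 ≤ s.sum + s.card) (g : ℕ) :
    ((s.sum + s.card - 2 + 2 * g).factorial : ℚ) *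
      coeff (s.sum + s.card - 2 + 2 * g) (starSeries s) = a g s := by
  rw [starSeries_eq s h, coeff_C_mul, add_comm (_ - 2), coeff_X_pow_mul, coeff_expand_mul,
    coeff_mk, a, add_comm (_ - 2)]
  ring

/-- Factorizations exist only for lengths of the parity of `n + m`, from `n + m - 2` on. -/
theorem coeff_starSeries_eq_zero (s : Multiset ℕ) (h : 2 ≤ s.sum + s.card) (r : ℕ)
    (hr : ∀ g, s.sum + s.card - 2 + 2 * g ≠ r) : coeff r (starSeries s) = 0 := by
  rw [starSeries_eq s h, coeff_C_mul, coeff_X_pow_mul']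
  split_ifs with hle
  · rw [coeff_expand_of_not_dvd, mul_zero]
    rintro ⟨g, hg⟩
    exact hr g (by omega)
  · rw [mul_zero]

/-! ### Joining and cutting cycles -/

/-- A transposition of two letters of a cycle cuts the cycle between them; read backwards, a
transposition of letters of two cycles joins these. -/
theorem swap_mul_formPerm_append {V : Type*} [DecidableEq V] (x y : V) (l₁ l₂ : List V)
    (h : (x :: l₁ ++ y :: l₂).Nodup) :
    swap x y * (x :: l₁ ++ y :: l₂).formPerm = (x :: l₁).formPerm * (y :: l₂).formPerm := by
  induction l₁ generalizing x with
  | nil => simp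
  | cons z l₁ ih =>
    have hxy : x ≠ y := by rintro rfl; simp at h
    have hzy : z ≠ y := by rintro rfl; simp at h
    have h' := ih z (List.nodup_cons.1 h).2
    have hs : swap x y * swap x z = swap x z * swap z y := by
      rw [mul_swap_eq_swap_mul (swap x z) z y, swap_apply_right,
        swap_apply_of_ne_of_ne hxy.symm hzy.symm]
    rw [List.cons_append, List.cons_append, List.formPerm_cons_cons, List.formPerm_cons_cons,
      ← mul_assoc, hs, mul_assoc, mul_assoc, ← h', List.cons_append]

theorem sum_toFinset_eq_sum_range {V R : Type*} [DecidableEq V] [AddCommMonoid R] (f : ℕ → R)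
    (g : V → R) (l : List V) (hl : l.Nodup) (h : ∀ l₁ j l₂, l = l₁ ++ j :: l₂ → g j = f l₁.length) :
    ∑ j ∈ l.toFinset, g j = ∑ k ∈ Finset.range l.length, f k := by
  induction l generalizing f with
  | nil => simp
  | cons x l ih =>
    rw [List.toFinset_cons, Finset.sum_insert (by simpa using (List.nodup_cons.1 hl).1),
      ih (fun k => f (k + 1)) (List.nodup_cons.1 hl).2
        (fun l₁ j l₂ e => by simpa using h (x :: l₁) j l₂ (by simp [e])),
      List.length_cons, Finset.sum_range_succ', add_comm, h [] x l rfl]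
    rfl

section Cycles

variable {V : Type*} [Fintype V] [DecidableEq V]

/-- The cycle lengths of `σ` on the set `T`, the fixed points in `T` included. Meaningful when
`σ` moves elements of `T` only. -/
def cycleParts (T : Finset V) (σ : Perm V) : Multiset ℕ :=
  σ.cycleType + Multiset.replicate (T.card - σ.support.card) 1

/-- `σ` moves elements of `T` only, the cycle of `σ` through the first element of `l` is `l`
(a list of length one for a fixed point), and `ρ` is the rest of `σ`. -/
structure IsCycleSplit (T : Finset V) (σ : Perm V) (l : List V) (ρ : Perm V) : Prop where
  nodup : l.Nodup
  subset : l.toFinset ⊆ T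
  eq_mul : σ = l.formPerm * ρ
  support_subset : ρ.support ⊆ T \ l.toFinset

namespace IsCycleSplit

variable {T : Finset V} {σ ρ : Perm V} {l : List V}

theorem disjoint (h : IsCycleSplit T σ l ρ) : l.formPerm.Disjoint ρ := by
  rw [Perm.disjoint_iff_disjoint_support]
  exact Finset.disjoint_of_subset_left (List.support_formPerm_le l)
    (Finset.disjoint_of_subset_right h.support_subset Finset.disjoint_sdiff)

theorem support_subset_self (h : IsCycleSplit T σ l ρ) : σ.support ⊆ T := by
  rw [h.eq_mul]
  refine (Perm.support_mul_le _ _).trans (Finset.union_subset ?_ ?_)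
  · exact (List.support_formPerm_le l).trans h.subset
  · exact h.support_subset.trans Finset.sdiff_subset

theorem cycleParts_eq (h : IsCycleSplit T σ l ρ) (hl : l ≠ []) :
    cycleParts T σ = l.length ::ₘ cycleParts (T \ l.toFinset) ρ := by
  have hT : (T \ l.toFinset).card = T.card - l.length := by
    rw [Finset.card_sdiff_of_subset h.subset, List.toFinset_card_of_nodup h.nodup]
  have hT' : l.length ≤ T.card := by
    rw [← List.toFinset_card_of_nodup h.nodup]
    exact Finset.card_le_card h.subset
  have hρ := Finset.card_le_card h.support_subset
  have hd := h.disjoint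
  rw [cycleParts, cycleParts, hT]
  rw [hT] at hρ
  match l, hl with
  | [x], _ =>
    rw [h.eq_mul, List.formPerm_singleton, one_mul]
    rw [List.length_singleton] at *
    rw [show T.card - ρ.support.card = T.card - 1 - ρ.support.card + 1 by omega,
      Multiset.replicate_succ, Multiset.add_cons]
  | x :: y :: m, _ =>
    rw [h.eq_mul, hd.cycleType_mul, (List.isCycle_formPerm h.nodup (by simp)).cycleType,
      hd.card_support_mul, List.support_formPerm_of_nodup _ h.nodup (by simp),
      List.toFinset_card_of_nodup h.nodup, add_assoc, Multiset.singleton_add, Nat.sub_sub]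

/-- A cycle of the rest may be split off next. -/
theorem trans {l' : List V} {ρ' : Perm V} (h : IsCycleSplit T σ l ρ)
    (h' : IsCycleSplit (T \ l.toFinset) ρ l' ρ') :
    IsCycleSplit T σ l' (l.formPerm * ρ') where
  nodup := h'.nodup
  subset := h'.subset.trans Finset.sdiff_subset
  eq_mul := by
    have hd : l.formPerm.Disjoint l'.formPerm := by
      rw [Perm.disjoint_iff_disjoint_support]
      exact Finset.disjoint_of_subset_left (List.support_formPerm_le l)
        (Finset.disjoint_of_subset_right ((List.support_formPerm_le l').trans h'.subset)
          Finset.disjoint_sdiff)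
    rw [h.eq_mul, h'.eq_mul, ← mul_assoc, ← mul_assoc, hd.commute.eq]
  support_subset := by
    refine (Perm.support_mul_le _ _).trans (Finset.union_subset ?_ ?_)
    · refine (List.support_formPerm_le l).trans fun x hx => Finset.mem_sdiff.2 ⟨h.subset hx, ?_⟩
      exact fun hx' => (Finset.mem_sdiff.1 (h'.subset hx')).2 hx
    · refine h'.support_subset.trans fun x hx => ?_
      simp only [Finset.mem_sdiff] at hx ⊢
      exact ⟨hx.1.1, hx.2⟩

theorem rotate (h : IsCycleSplit T σ l ρ) {l' : List V} (hl : l ~r l') :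
    IsCycleSplit T σ l' ρ := by
  have hs : l'.toFinset = l.toFinset := by
    ext x
    rw [List.mem_toFinset, List.mem_toFinset, hl.mem_iff]
  exact ⟨hl.nodup_iff.1 h.nodup, hs ▸ h.subset,
    List.formPerm_eq_of_isRotated h.nodup hl ▸ h.eq_mul, hs ▸ h.support_subset⟩

end IsCycleSplit

/-- The cycle of any letter may be split off. -/
theorem exists_isCycleSplit {T : Finset V} {σ : Perm V} (hσ : σ.support ⊆ T) {j : V}
    (hj : j ∈ T) : ∃ l ρ, IsCycleSplit T σ (j :: l) ρ := by
  by_cases hjσ : j ∈ σ.support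
  · have h0 := Perm.toList_getElem_zero σ j hjσ
    obtain ⟨x, l, hl⟩ := List.exists_cons_of_ne_nil
      (mt Perm.toList_eq_nil_iff.1 (not_not.2 hjσ))
    have hx : x = j := by simpa [hl] using h0
    subst hx
    have hf : (x :: l).formPerm = σ.cycleOf x := by rw [← hl, Perm.formPerm_toList]
    have hs : (x :: l).toFinset = (σ.cycleOf x).support := by
      ext y
      rw [List.mem_toFinset, ← hl, Perm.mem_toList_iff, Perm.mem_support_cycleOf_iff]
    have hc := Perm.cycleOf_mem_cycleFactorsFinset_iff.2 hjσ
    refine ⟨l, (σ.cycleOf x)⁻¹ * σ, hl ▸ Perm.nodup_toList σ x, ?_, ?_, ?_⟩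
    · rw [hs]
      exact (Perm.support_cycleOf_le σ x).trans hσ
    · rw [hf, mul_inv_cancel_left]
    · have hd := Perm.disjoint_mul_inv_of_mem_cycleFactorsFinset hc
      have hcomm : (σ.cycleOf x)⁻¹ * σ = σ * (σ.cycleOf x)⁻¹ :=
        (Perm.self_mem_cycle_factors_commute hc).inv_left.eq
      rw [hs, hcomm]
      rw [Perm.disjoint_iff_disjoint_support] at hd
      refine Finset.subset_sdiff.2 ⟨?_, hd⟩
      refine (Perm.support_mul_le _ _).trans (Finset.union_subset hσ ?_)
      rw [Perm.support_inv]
      exact (Perm.support_cycleOf_le σ x).trans hσ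
  · refine ⟨[], σ, by simp, by simpa using hj, by simp, fun x hx => ?_⟩
    rw [Finset.mem_sdiff]
    refine ⟨hσ hx, fun hx' => hjσ ?_⟩
    simp only [List.toFinset_cons, List.toFinset_nil, insert_empty_eq,
      Finset.mem_singleton] at hx'
    exact hx' ▸ hx

/-- A sum over the letters of a quantity that depends only on the length of the cycle through
the letter is a sum over the cycles, weighted with their lengths. -/
theorem sum_eq_sum_cycleParts {R : Type*} [AddCommMonoid R] (f : ℕ → R) (g : V → R)
    (T : Finset V) (σ : Perm V) (hσ : σ.support ⊆ T)
    (h : ∀ j l ρ, IsCycleSplit T σ (j :: l) ρ → g j = f (l.length + 1)) :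
    ∑ j ∈ T, g j = ((cycleParts T σ).map fun a => a • f a).sum := by
  induction T using Finset.strongInduction generalizing σ with
  | H T ih =>
    rcases T.eq_empty_or_nonempty with rfl | ⟨j, hj⟩
    · have : σ = 1 := by
        rw [← Perm.support_eq_empty_iff]
        exact Finset.subset_empty.1 hσ
      simp [this, cycleParts]
    · obtain ⟨l, ρ, hs⟩ := exists_isCycleSplit hσ hj
      have hsub : T \ (j :: l).toFinset ⊂ T :=
        Finset.sdiff_ssubset hs.subset ⟨j, by simp⟩
      have h1 := ih _ hsub ρ hs.support_subset fun k m τ hk => h k m _ (hs.trans hk)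
      have h2 : ∀ k ∈ (j :: l).toFinset, g k = f (l.length + 1) := by
        intro k hk
        obtain ⟨l₁, l₂, hl⟩ := List.append_of_mem (List.mem_toFinset.1 hk)
        have hr : (j :: l) ~r (k :: l₂ ++ l₁) := by
          rw [hl]
          exact List.isRotated_append
        rw [h k (l₂ ++ l₁) ρ (hs.rotate hr)]
        have := hr.perm.length_eq
        simp only [List.length_cons, List.cons_append] at this
        rw [← this]
      rw [← Finset.sum_sdiff hs.subset, h1, Finset.sum_congr rfl h2,
        hs.cycleParts_eq (List.cons_ne_nil _ _), Multiset.map_cons, Multiset.sum_cons, add_comm,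
        Finset.sum_const, List.toFinset_card_of_nodup hs.nodup, List.length_cons]

namespace IsCycleSplit

variable {T : Finset V} {σ ρ : Perm V} {i : V} {l : List V}

/-- Two disjoint lists split off two cycles, one after the other. -/
theorem of_append {l₁ l₂ : List V} {τ : Perm V} (hn : (l₁ ++ l₂).Nodup)
    (hs : (l₁ ++ l₂).toFinset ⊆ T) (hτ : τ = l₁.formPerm * l₂.formPerm * ρ)
    (hρ : ρ.support ⊆ T \ (l₁ ++ l₂).toFinset) :
    IsCycleSplit T τ l₁ (l₂.formPerm * ρ) ∧
      IsCycleSplit (T \ l₁.toFinset) (l₂.formPerm * ρ) l₂ ρ := by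
  rw [List.toFinset_append] at hs hρ
  have hd : Disjoint l₁.toFinset l₂.toFinset := by
    rw [List.disjoint_toFinset_iff_disjoint]
    exact List.disjoint_of_nodup_append hn
  have h2 : IsCycleSplit (T \ l₁.toFinset) (l₂.formPerm * ρ) l₂ ρ :=
    ⟨hn.of_append_right, Finset.subset_sdiff.2 ⟨(Finset.union_subset_iff.1 hs).2, hd.symm⟩, rfl,
      by rwa [sdiff_sdiff_left]⟩
  exact ⟨⟨hn.of_append_left, (Finset.union_subset_iff.1 hs).1, by rw [hτ, mul_assoc],
    h2.support_subset_self⟩, h2⟩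

/-- A transposition that cuts the cycle `i :: l₁ ++ j :: l₂`. -/
theorem swap_mul_of_cut {l₁ l₂ : List V} {j : V} (h : IsCycleSplit T σ (i :: l₁ ++ j :: l₂) ρ) :
    swap i j * σ = (i :: l₁).formPerm * (j :: l₂).formPerm * ρ := by
  rw [h.eq_mul, ← mul_assoc, swap_mul_formPerm_append _ _ _ _ h.nodup]

theorem cycleParts_of_cut {l₁ l₂ : List V} {j : V}
    (h : IsCycleSplit T σ (i :: l₁ ++ j :: l₂) ρ) :
    cycleParts T (swap i j * σ) = (l₁.length + 1) ::ₘ (l₂.length + 1) ::ₘ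
      cycleParts (T \ (i :: l₁ ++ j :: l₂).toFinset) ρ := by
  obtain ⟨h1, h2⟩ := of_append h.nodup h.subset h.swap_mul_of_cut h.support_subset
  rw [h1.cycleParts_eq (by simp), h2.cycleParts_eq (by simp), sdiff_sdiff_left,
    List.toFinset_append]
  rfl

/-- A transposition that joins the cycles `i :: l` and `j :: m`. -/
theorem cycleParts_of_join {m : List V} {j : V} {ρ' : Perm V}
    (h : IsCycleSplit T σ (i :: l) ρ)
    (h' : IsCycleSplit (T \ (i :: l).toFinset) ρ (j :: m) ρ') :
    cycleParts T (swap i j * σ) = (l.length + 1 + (m.length + 1)) ::ₘ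
      (cycleParts (T \ (i :: l).toFinset) ρ).erase (m.length + 1) := by
  have hn : (i :: l ++ j :: m).Nodup := by
    refine h.nodup.append h'.nodup ?_
    rw [← List.disjoint_toFinset_iff_disjoint]
    exact Finset.disjoint_of_subset_right h'.subset Finset.disjoint_sdiff
  have h1 : IsCycleSplit T (swap i j * σ) (i :: l ++ j :: m) ρ' := by
    refine ⟨hn, ?_, ?_, ?_⟩
    · rw [List.toFinset_append]
      exact Finset.union_subset h.subset (h'.subset.trans Finset.sdiff_subset)
    · rw [h.eq_mul, h'.eq_mul, ← mul_assoc _ _ ρ', ← swap_mul_formPerm_append _ _ _ _ hn, mul_assoc,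
        swap_mul_self_mul]
    · have := h'.support_subset
      rwa [sdiff_sdiff_left, Finset.sup_eq_union, ← List.toFinset_append] at this
  rw [h1.cycleParts_eq (by simp), h'.cycleParts_eq (by simp), List.length_cons,
    Multiset.erase_cons_head, sdiff_sdiff_left, Finset.sup_eq_union, ← List.toFinset_append]
  congr 1
  rw [List.length_append, List.length_cons, List.length_cons]

/-- The cycle types obtained by multiplying with the star transpositions on `T`. -/
theorem sum_cycleParts_swap_mul {R : Type*} [AddCommMonoid R] (G : Multiset ℕ → R)
    (h : IsCycleSplit T σ (i :: l) ρ) :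
    ∑ j ∈ T.erase i, G (cycleParts T (swap i j * σ)) =
      ((cycleParts (T \ (i :: l).toFinset) ρ).map fun a =>
        a • G ((l.length + 1 + a) ::ₘ (cycleParts (T \ (i :: l).toFinset) ρ).erase a)).sum
      + ∑ k ∈ Finset.range l.length,
        G ((k + 1) ::ₘ (l.length - k) ::ₘ cycleParts (T \ (i :: l).toFinset) ρ) := by
  have hsub : l.toFinset ⊆ T.erase i := fun x hx => Finset.mem_erase.2
    ⟨fun e => (List.nodup_cons.1 h.nodup).1 (by simpa [← e] using hx), h.subset (by simp_all)⟩
  have hdiff : T.erase i \ l.toFinset = T \ (i :: l).toFinset := by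
    ext x
    simp
    tauto
  rw [← Finset.sum_sdiff hsub, hdiff]
  congr 1
  · exact sum_eq_sum_cycleParts
      (fun a => G ((l.length + 1 + a) ::ₘ (cycleParts (T \ (i :: l).toFinset) ρ).erase a)) _ _ _
      h.support_subset fun j m ρ' h' => by rw [h.cycleParts_of_join h']
  · refine sum_toFinset_eq_sum_range _ _ _ (List.nodup_cons.1 h.nodup).2 fun l₁ j l₂ e => ?_
    subst e
    rw [cycleParts_of_cut (by exact h)]
    simp only [List.length_append, List.length_cons, Nat.add_sub_cancel_left, List.cons_append]

/-- If multiplying with `(i j)` makes `j` a fixed point, then `j` is the last letter of the cycle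
`i :: l`, and this letter is removed from the cycle. -/
theorem cycleParts_erase {j : V} (hj : j ≠ i) (h : IsCycleSplit T σ (i :: l) ρ) (hσ : σ j = i) :
    l ≠ [] ∧ cycleParts (T.erase j) (swap i j * σ) =
      l.length ::ₘ cycleParts (T \ (i :: l).toFinset) ρ := by
  have hρ : ∀ x ∈ i :: l, ρ x = x := fun x hx => by
    by_contra hne
    exact (Finset.mem_sdiff.1 (h.support_subset (Perm.mem_support.2 hne))).2
      (List.mem_toFinset.2 hx)
  have hl : j ∈ l := by
    by_contra hjl
    have h1 : (i :: l).formPerm j = j := List.formPerm_apply_of_notMem (by simp [hj, hjl])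
    rw [h.eq_mul, h.disjoint.commute.eq, Perm.mul_apply, h1] at hσ
    exact hj (ρ.injective (hσ.trans (hρ i (by simp)).symm))
  obtain ⟨l₁, l₂, rfl⟩ := List.append_of_mem hl
  have hτ := swap_mul_of_cut (i := i) (l₁ := l₁) (by exact h)
  have hn : (i :: l₁ ++ j :: l₂).Nodup := h.nodup
  have hl₂ : l₂ = [] := by
    match l₂ with
    | [] => rfl
    | y :: m =>
      have h1 := congrArg (fun τ : Perm V => τ j) hτ
      simp only [Perm.mul_apply, hσ, swap_apply_left, hρ j (by simp)] at h1
      rw [List.formPerm_apply_head _ _ _ hn.of_append_right, List.formPerm_apply_of_notMem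
        fun hy => List.disjoint_of_nodup_append hn hy (by simp)] at h1
      have := hn.of_append_right
      simp [h1] at this
  subst hl₂
  refine ⟨by simp, ?_⟩
  rw [List.formPerm_singleton, mul_one] at hτ
  have hset : T.erase j \ (i :: l₁).toFinset = T \ (i :: (l₁ ++ [j])).toFinset := by
    ext x
    simp
    tauto
  have hsplit : IsCycleSplit (T.erase j) (swap i j * σ) (i :: l₁) ρ := by
    refine ⟨hn.of_append_left, fun x hx => Finset.mem_erase.2 ⟨?_, h.subset ?_⟩, hτ,
      hset ▸ h.support_subset⟩
    · rintro rfl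
      exact List.disjoint_of_nodup_append hn (List.mem_toFinset.1 hx) (by simp)
    · simp only [List.mem_toFinset, List.mem_cons, List.mem_append] at hx ⊢
      tauto
  rw [hsplit.cycleParts_eq (by simp), hset]
  simp

end IsCycleSplit

end Cycles

/-! ### Counting words in star transpositions -/

/-- The product of the star transpositions `(i f₁) ⋯ (i f_r)`. -/
def starProd {V : Type*} [DecidableEq V] (i : V) {r : ℕ} (f : Fin r → V) : Perm V :=
  (List.ofFn fun t => swap i (f t)).prod

theorem starProd_cons {V : Type*} [DecidableEq V] (i j : V) {r : ℕ} (f : Fin r → V) :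
    starProd i (Fin.cons j f : Fin (r + 1) → V) = swap i j * starProd i f := by
  simp [starProd, List.ofFn_succ]

theorem image_cons {V : Type*} [DecidableEq V] (j : V) {r : ℕ} (f : Fin r → V) :
    Finset.univ.image (Fin.cons j f : Fin (r + 1) → V) = insert j (Finset.univ.image f) := by
  ext x
  simp [Fin.exists_fin_succ, eq_comm]

section Words

variable {V : Type*} [Fintype V] [DecidableEq V]

/-- The words `f` of length `r` whose set of letters is `S` and whose product
`(i f₁) ⋯ (i f_r)` is `σ`. -/
def starWords (i : V) (r : ℕ) (S : Finset V) (σ : Perm V) : Finset (Fin r → V) :=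
  {f | Finset.univ.image f = S ∧ starProd i f = σ}

theorem card_starWords_zero (i : V) (S : Finset V) (σ : Perm V) :
    (starWords i 0 S σ).card = if S = ∅ ∧ σ = 1 then 1 else 0 := by
  split_ifs with h
  · simp [starWords, starProd, h.1, h.2]
  · rw [Finset.card_eq_zero, starWords, Finset.filter_eq_empty_iff]
    rintro f - ⟨h1, h2⟩
    exact h ⟨by simpa [eq_comm] using h1, by simpa [starProd, eq_comm] using h2⟩

/-- Removal of the first factor `(i j)`: either `j` occurs again, or it does not. -/
theorem card_starWords_succ (i : V) (r : ℕ) (S : Finset V) (σ : Perm V) :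
    (starWords i (r + 1) S σ).card = ∑ j ∈ S, ((starWords i r S (swap i j * σ)).card +
      (starWords i r (S.erase j) (swap i j * σ)).card) := by
  have hσ (j : V) (τ : Perm V) : swap i j * τ = σ ↔ τ = swap i j * σ := by
    rw [← mul_right_inj (swap i j), swap_mul_self_mul]
  have h1 (j : V) (hj : j ∈ S) :
      (starWords i r S (swap i j * σ)).card + (starWords i r (S.erase j) (swap i j * σ)).card =
      ∑ f : Fin r → V, if insert j (Finset.univ.image f) = S ∧ swap i j * starProd i f = σ
        then 1 else 0 := by
    rw [← Finset.card_filter, ← Finset.card_union_of_disjoint, starWords, starWords,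
      ← Finset.filter_or]
    · congr 1
      refine Finset.filter_congr fun f _ => ?_
      rw [hσ, ← or_and_right]
      refine and_congr_left fun _ => ⟨?_, fun h => ?_⟩
      · rintro (h | h) <;> simp [h, hj]
      · by_cases hf : j ∈ Finset.univ.image f
        · exact Or.inl (by rw [← h, Finset.insert_eq_of_mem hf])
        · exact Or.inr (by rw [← h, Finset.erase_insert hf])
    · refine Finset.disjoint_filter.2 fun f _ h h' => ?_
      have := h.1.symm.trans h'.1
      exact Finset.notMem_erase j S (this ▸ hj)
  have h0 (j : V) (hj : j ∉ S) :
      ∑ f : Fin r → V, (if insert j (Finset.univ.image f) = S ∧ swap i j * starProd i f = σ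
        then 1 else 0) = 0 :=
    Finset.sum_eq_zero fun f _ => if_neg fun ⟨h, _⟩ => hj (h ▸ Finset.mem_insert_self _ _)
  rw [Finset.sum_congr rfl h1, Finset.sum_subset (Finset.subset_univ S) fun j _ hj => h0 j hj,
    ← Fintype.sum_prod_type' (f := fun j (f : Fin r → V) =>
      if insert j (Finset.univ.image f) = S ∧ swap i j * starProd i f = σ then 1 else 0),
    starWords, Finset.card_filter]
  refine (Fintype.sum_equiv (Fin.consEquiv fun _ => V) _ _ fun x => ?_).symm
  rw [show Fin.consEquiv (fun _ => V) x = Fin.cons x.1 x.2 from rfl, starProd_cons, image_cons]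

theorem list_prod_apply_eq_self {V : Type*} (l : List (Perm V)) (x : V)
    (h : ∀ τ ∈ l, τ x = x) : l.prod x = x := by
  induction l with
  | nil => simp
  | cons τ l ih =>
    rw [List.prod_cons, Perm.mul_apply, ih fun τ hτ => h τ (List.mem_cons_of_mem _ hτ),
      h τ List.mem_cons_self]

/-- A letter that does not occur in a word is fixed by the product. -/
theorem card_starWords_eq_zero {i x : V} (r : ℕ) {S : Finset V} {σ : Perm V} (hx : x ∉ S)
    (hxi : x ≠ i) (hσ : σ x ≠ x) : (starWords i r S σ).card = 0 := by
  rw [Finset.card_eq_zero, starWords, Finset.filter_eq_empty_iff]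
  rintro f - ⟨h1, rfl⟩
  refine hσ (list_prod_apply_eq_self _ _ fun τ hτ => ?_)
  obtain ⟨t, rfl⟩ := (List.mem_ofFn' _ _).1 hτ
  refine swap_apply_of_ne_of_ne hxi ?_
  rintro rfl
  exact hx (h1 ▸ Finset.mem_image_of_mem f (Finset.mem_univ t))

theorem sum_cycleParts {T : Finset V} {σ : Perm V} (hσ : σ.support ⊆ T) :
    (cycleParts T σ).sum = T.card := by
  have := Finset.card_le_card hσ
  rw [cycleParts, Multiset.sum_add, Perm.sum_cycleType, Multiset.sum_replicate, smul_eq_mul]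
  omega

theorem support_swap_mul_subset {T : Finset V} {σ : Perm V} {i j : V} (hσ : σ.support ⊆ T)
    (hi : i ∈ T) (hj : j ∈ T) : (swap i j * σ).support ⊆ T := by
  intro x hx
  by_contra hxT
  have h1 : σ x = x := by
    by_contra h
    exact hxT (hσ (Perm.mem_support.2 h))
  refine Perm.mem_support.1 hx ?_
  rw [Perm.mul_apply, h1]
  exact swap_apply_of_ne_of_ne (by rintro rfl; exact hxT hi) (by rintro rfl; exact hxT hj)

/-- The words without a second letter `j` after the initial `(i j)` contribute for one `j` only,
namely for the `j` that `σ` sends to the pivot `i`. -/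
theorem sum_card_starWords_erase {T : Finset V} {σ ρ : Perm V} {i : V} {l : List V} {r : ℕ}
    (h : IsCycleSplit T σ (i :: l) ρ) (G : Multiset ℕ → ℚ)
    (ih : ∀ (T : Finset V) (σ : Perm V), i ∈ T → σ.support ⊆ T →
      ((starWords i r (T.erase i) σ).card : ℚ) = G (cycleParts T σ)) :
    ∑ j ∈ T.erase i, ((starWords i r ((T.erase i).erase j) (swap i j * σ)).card : ℚ) =
      if l = [] then 0 else G (l.length ::ₘ cycleParts (T \ (i :: l).toFinset) ρ) := by
  have hi : i ∈ T := h.subset (by simp)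
  have hzero : ∀ j ∈ T.erase i, σ j ≠ i →
      ((starWords i r ((T.erase i).erase j) (swap i j * σ)).card : ℚ) = 0 := by
    intro j hj hσj
    rw [card_starWords_eq_zero r (Finset.notMem_erase j _) (Finset.ne_of_mem_erase hj),
      Nat.cast_zero]
    rw [Perm.mul_apply, Ne, swap_apply_eq_iff, swap_apply_right]
    exact hσj
  by_cases hσi : σ i = i
  · have hl : l = [] := by
      rw [h.eq_mul, Perm.mul_apply] at hσi
      have hρ : ρ i = i := by
        by_contra hne
        exact (Finset.mem_sdiff.1 (h.support_subset (Perm.mem_support.2 hne))).2 (by simp)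
      match l with
      | [] => rfl
      | y :: m =>
        have hn := h.nodup
        rw [hρ, List.formPerm_apply_head _ _ _ hn] at hσi
        simp [hσi] at hn
    rw [if_pos hl]
    exact Finset.sum_eq_zero fun j hj => hzero j hj fun e =>
      Finset.ne_of_mem_erase hj (σ.injective (e.trans hσi.symm))
  · obtain ⟨k, hk⟩ := σ.surjective i
    have hne : k ≠ i := by rintro rfl; exact hσi hk
    have hmem : k ∈ T.erase i := by
      refine Finset.mem_erase.2 ⟨hne, h.support_subset_self ?_⟩
      rw [Perm.mem_support, hk]
      exact hne.symm
    obtain ⟨hl, hc⟩ := h.cycleParts_erase hne hk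
    rw [if_neg hl, ← hc, Finset.sum_eq_single_of_mem _ hmem, Finset.erase_right_comm, ih]
    · exact Finset.mem_erase.2 ⟨hne.symm, hi⟩
    · refine Finset.subset_erase.2 ⟨support_swap_mul_subset h.support_subset_self hi
        (Finset.mem_of_mem_erase hmem), ?_⟩
      simp [Perm.mem_support, hk]
    · exact fun j hj hjk => hzero j hj fun e => hjk (σ.injective (e.trans hk.symm))

/-- The words with letters `T \ {i}` and product `σ` are counted by the coefficients of
`starSeries`, in the exponential normalization. -/
theorem card_starWords (i : V) (r : ℕ) (T : Finset V) (σ : Perm V) (hi : i ∈ T)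
    (hσ : σ.support ⊆ T) :
    ((starWords i r (T.erase i) σ).card : ℚ) =
      r.factorial * coeff r (starSeries (cycleParts T σ)) := by
  induction r generalizing T σ with
  | zero =>
    obtain ⟨l, ρ, h⟩ := exists_isCycleSplit hσ hi
    have hcard : 1 ≤ (cycleParts T σ).card := by
      rw [h.cycleParts_eq (List.cons_ne_nil _ _), Multiset.card_cons]
      omega
    rw [card_starWords_zero, Nat.factorial_zero, Nat.cast_one, one_mul]
    by_cases hT : T.erase i = ∅
    · have hT : T = {i} := by
        rw [← Finset.insert_erase hi, hT]
        rfl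
      have h1 : σ = 1 := by
        rw [← Perm.card_support_le_one]
        simpa [hT] using Finset.card_le_card hσ
      have h2 : cycleParts T σ = {1} := by
        simp [hT, h1, cycleParts]
      rw [h2]
      simp [hT, h1, starSeries, shQuot_one]
    · rw [if_neg fun e => hT e.1, Nat.cast_zero, starSeries, coeff_C_mul]
      have hc := Finset.card_pos.2 (Finset.nonempty_iff_ne_empty.2 hT)
      rw [Finset.card_erase_of_mem hi] at hc
      obtain ⟨e, he⟩ : ∃ e, (cycleParts T σ).sum + (cycleParts T σ).card - 2 = e + 1 := by
        rw [sum_cycleParts hσ]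
        exact ⟨T.card + (cycleParts T σ).card - 3, by omega⟩
      rw [he, sh_one_eq]
      simp
  | succ r ih =>
    obtain ⟨l, ρ, h⟩ := exists_isCycleSplit hσ hi
    set G : Multiset ℕ → ℚ := fun s => r.factorial * coeff r (starSeries s) with hG
    have h1 : ∑ j ∈ T.erase i, ((starWords i r (T.erase i) (swap i j * σ)).card : ℚ) =
        ∑ j ∈ T.erase i, G (cycleParts T (swap i j * σ)) :=
      Finset.sum_congr rfl fun j hj => ih T _ hi
        (support_swap_mul_subset hσ hi (Finset.mem_of_mem_erase hj))
    have h2 : ((r + 1).factorial : ℚ) * coeff (r + 1) (starSeries (cycleParts T σ)) =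
        r.factorial * coeff r (derivative ℚ (starSeries (cycleParts T σ))) := by
      rw [coeff_derivative, Nat.factorial_succ]
      push_cast
      ring
    rw [card_starWords_succ, h2]
    push_cast
    rw [Finset.sum_add_distrib, h1, h.sum_cycleParts_swap_mul G, sum_card_starWords_erase h G ih,
      h.cycleParts_eq (List.cons_ne_nil _ _), List.length_cons, derivative_starSeries, map_add,
      map_add, mul_add, mul_add, map_sum, Finset.mul_sum, map_multiset_sum,
      Multiset.map_map, ← Multiset.sum_map_mul_left]
    congr 1
    · congr 1
      refine congrArg _ (Multiset.map_congr rfl fun a _ => ?_)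
      rw [Function.comp_apply, map_nsmul, nsmul_eq_mul, nsmul_eq_mul, mul_left_comm]
    · simp only [List.length_eq_zero_iff]
      split_ifs <;> simp [hG]

end Words

/-! ### Transitive star factorizations -/

theorem cycleParts_univ {V : Type*} [Fintype V] [DecidableEq V] (σ : Perm V) :
    cycleParts Finset.univ σ = σ.partition.parts := by
  rw [cycleParts, Perm.parts_partition, Finset.card_univ]

/-- Star transpositions generate a transitive group if and only if every letter other than the
pivot occurs. -/
theorem isTransitive_iff {n r : ℕ} (i : Fin n) (f : Fin r → Fin n) (hf : ∀ t, f t ≠ i) :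
    IsTransitive (List.ofFn fun t => swap i (f t)) ↔
      Finset.univ.image f = Finset.univ.erase i := by
  set H := Subgroup.closure {σ : Perm (Fin n) | σ ∈ List.ofFn fun t => swap i (f t)} with hH
  have hsub : Finset.univ.image f ⊆ Finset.univ.erase i := by
    intro c hc
    obtain ⟨t, -, rfl⟩ := Finset.mem_image.1 hc
    simp [hf t]
  constructor
  · intro h
    refine hsub.antisymm fun c hc => ?_
    by_contra hcf
    obtain ⟨⟨τ, hτ⟩, hτc⟩ := h.exists_smul_eq c i
    have hle : H ≤ MulAction.stabilizer (Perm (Fin n)) c := by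
      rw [hH, Subgroup.closure_le]
      intro σ hσ
      obtain ⟨t, rfl⟩ := (List.mem_ofFn' _ _).1 hσ
      refine swap_apply_of_ne_of_ne (Finset.ne_of_mem_erase hc) ?_
      rintro rfl
      exact hcf (Finset.mem_image_of_mem f (Finset.mem_univ t))
    exact Finset.ne_of_mem_erase hc ((hle hτ).symm.trans hτc)
  · intro h
    refine (MulAction.isPretransitive_iff_base i).2 fun c => ?_
    by_cases hc : c = i
    · exact ⟨1, by rw [one_smul, hc]⟩
    · have hcf : c ∈ Finset.univ.image f := h ▸ Finset.mem_erase.2 ⟨hc, Finset.mem_univ c⟩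
      obtain ⟨t, -, rfl⟩ := Finset.mem_image.1 hcf
      exact ⟨⟨swap i (f t), Subgroup.subset_closure ((List.mem_ofFn' _ _).2 ⟨t, rfl⟩)⟩,
        swap_apply_left _ _⟩

theorem starFactorizations_eq_image {n : ℕ} (i : Fin n) (r : ℕ) (σ : Perm (Fin n)) :
    starFactorizations i r σ = (fun f : Fin r → Fin n => List.ofFn fun t => swap i (f t)) ''
      (starWords i r (Finset.univ.erase i) σ : Set (Fin r → Fin n)) := by
  ext l
  simp only [starFactorizations, Set.mem_ofPred_eq, starWords, Set.mem_image, Finset.coe_filter,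
    Finset.mem_univ, true_and]
  constructor
  · rintro ⟨rfl, hl, hσ, ht⟩
    choose f hf using fun t : Fin l.length => hl (l.get t) (List.get_mem l t)
    have hlf : (List.ofFn fun t => swap i (f t)) = l := by
      conv_rhs => rw [← List.ofFn_get l]
      exact congrArg List.ofFn (funext fun t => (hf t).2.symm)
    exact ⟨f, ⟨(isTransitive_iff i f fun t => (hf t).1).1 (by rwa [hlf]),
      by rw [starProd, hlf, hσ]⟩, hlf⟩
  · rintro ⟨f, ⟨hf, hσ⟩, rfl⟩
    have hfi : ∀ t, f t ≠ i := fun t => Finset.ne_of_mem_erase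
      (hf ▸ Finset.mem_image_of_mem f (Finset.mem_univ t))
    refine ⟨by simp, ?_, hσ, (isTransitive_iff i f hfi).2 hf⟩
    intro τ hτ
    obtain ⟨t, rfl⟩ := (List.mem_ofFn' _ _).1 hτ
    exact ⟨f t, hfi t, rfl⟩

theorem ncard_starFactorizations {n : ℕ} (i : Fin n) (r : ℕ) (σ : Perm (Fin n)) :
    (starFactorizations i r σ).ncard = (starWords i r (Finset.univ.erase i) σ).card := by
  rw [starFactorizations_eq_image, Set.ncard_image_of_injective, Set.ncard_coe_finset]
  intro f f' h
  have h := List.ofFn_injective h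
  funext t
  have := congrArg (fun τ : Perm (Fin n) => τ i) (congrFun h t)
  simpa using this

theorem sum_parts_partition {n : ℕ} (σ : Perm (Fin n)) : σ.partition.parts.sum = n := by
  rw [σ.partition.parts_sum, Fintype.card_fin]

theorem one_le_card_parts {n : ℕ} (hn : 1 ≤ n) (α : n.Partition) : 1 ≤ α.parts.card := by
  rw [Nat.one_le_iff_ne_zero, Ne, Multiset.card_eq_zero]
  intro h
  have := α.parts_sum
  rw [h, Multiset.sum_zero] at this
  omega

theorem card_starWords_univ {n : ℕ} (i : Fin n) (r : ℕ) {σ : Perm (Fin n)} {s : Multiset ℕ}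
    (hσ : σ.partition.parts = s) :
    ((starWords i r (Finset.univ.erase i) σ).card : ℚ) = r.factorial * coeff r (starSeries s) := by
  rw [card_starWords i r _ σ (Finset.mem_univ i) (Finset.subset_univ _), cycleParts_univ, hσ]

theorem ncard_starFactorizations_eq {n : ℕ} (hn : 1 ≤ n) (α : n.Partition) (g : ℕ) (i : Fin n)
    (σ : Perm (Fin n)) (hσ : σ.partition.parts = α.parts) :
    ((starFactorizations i (n + α.parts.card - 2 + 2 * g) σ).ncard : ℚ) = a g α.parts := by
  have h := factorial_mul_coeff_starSeries α.parts
    (by rw [α.parts_sum]; have := one_le_card_parts hn α; omega) g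
  rw [α.parts_sum] at h
  rw [ncard_starFactorizations, card_starWords_univ i _ hσ, h]

/-! ### Transitive powers -/

theorem sum_pow_eq_sum_piFinset {A V : Type*} [Semiring A] [DecidableEq V] (s : Finset V)
    (x : V → A) (r : ℕ) :
    (∑ j ∈ s, x j) ^ r =
      ∑ f ∈ Fintype.piFinset fun _ : Fin r => s, (List.ofFn fun t => x (f t)).prod := by
  induction r with
  | zero => simp
  | succ r ih =>
    rw [pow_succ', ih, Finset.sum_mul_sum, ← Finset.sum_product']
    refine Finset.sum_equiv (Fin.consEquiv fun _ => V) (fun y => ?_) fun y _ => ?_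
    · simp [Fin.consEquiv, Fin.forall_fin_succ]
    · simp [Fin.consEquiv, List.ofFn_succ]

theorem T_of {n : ℕ} (w : FreeMonoid (Perm (Fin n))) [Decidable (IsTransitive w.toList)] :
    T n (MonoidAlgebra.of ℂ _ w) =
      if IsTransitive w.toList then MonoidAlgebra.of ℂ _ w.toList.prod else 0 := by
  simp only [T]
  simp

theorem transPow_eq_sum (n : ℕ) (hn : 1 ≤ n) (r : ℕ) :
    transPow n hn r = ∑ σ : Perm (Fin n),
      ((starWords (⟨n - 1, by omega⟩ : Fin n) r (Finset.univ.erase ⟨n - 1, by omega⟩) σ).card : ℂ) •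
        MonoidAlgebra.of ℂ (Perm (Fin n)) σ := by
  classical
  set i : Fin n := ⟨n - 1, by omega⟩ with hi
  have hI : Finset.Iio i = Finset.univ.erase i := by
    ext j
    have := j.2
    simp [hi, Fin.lt_def, Fin.ext_iff]
    omega
  have hw (f : Fin r → Fin n) : (List.ofFn fun t => MonoidAlgebra.of ℂ
      (FreeMonoid (Perm (Fin n))) (FreeMonoid.of (swap (f t) i))).prod =
      MonoidAlgebra.of ℂ _ (FreeMonoid.ofList (List.ofFn fun t => swap i (f t))) := by
    have h (l : List (Perm (Fin n))) : (l.map fun τ => MonoidAlgebra.of ℂ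
        (FreeMonoid (Perm (Fin n))) (FreeMonoid.of τ)).prod =
        MonoidAlgebra.of ℂ _ (FreeMonoid.ofList l) := by
      induction l with
      | nil => exact (map_one _).symm
      | cons τ l ih => rw [List.map_cons, List.prod_cons, ih, ← map_mul]; rfl
    rw [← h, List.map_ofFn]
    simp only [Function.comp_def, swap_comm i]
  rw [transPow, formalYjm, sum_pow_eq_sum_piFinset, map_sum, hI]
  have h1 (f : Fin r → Fin n) (hf : f ∈ Fintype.piFinset fun _ : Fin r => Finset.univ.erase i) :
      T n (List.ofFn fun t => MonoidAlgebra.of ℂ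
        (FreeMonoid (Perm (Fin n))) (FreeMonoid.of (swap (f t) i))).prod =
      if Finset.univ.image f = Finset.univ.erase i then MonoidAlgebra.of ℂ _ (starProd i f)
        else 0 := by
    rw [hw, T_of, FreeMonoid.toList_ofList]
    simp only [isTransitive_iff i f fun t => Finset.ne_of_mem_erase (Fintype.mem_piFinset.1 hf t)]
    rfl
  rw [Finset.sum_congr rfl h1, ← Finset.sum_filter]
  have h2 : ((Fintype.piFinset fun _ : Fin r => Finset.univ.erase i).filter fun f =>
      Finset.univ.image f = Finset.univ.erase i) =
      Finset.univ.filter fun f => Finset.univ.image f = Finset.univ.erase i := by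
    ext f
    simp only [Finset.mem_filter, Finset.mem_univ, true_and, and_iff_right_iff_imp,
      Fintype.mem_piFinset]
    exact fun h t => h ▸ Finset.mem_image_of_mem f (Finset.mem_univ t)
  rw [h2, ← Finset.sum_fiberwise (g := starProd i)]
  refine Finset.sum_congr rfl fun σ _ => ?_
  rw [Finset.filter_filter, Finset.sum_congr rfl (g := fun _ => MonoidAlgebra.of ℂ _ σ)
    fun f hf => by rw [(Finset.mem_filter.1 hf).2.2], Finset.sum_const, Nat.cast_smul_eq_nsmul]
  rfl

theorem sum_smul_classSum {n : ℕ} (c : Multiset ℕ → ℂ) :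
    ∑ α : n.Partition, c α.parts • classSum α =
      ∑ σ : Perm (Fin n), c σ.partition.parts • MonoidAlgebra.of ℂ (Perm (Fin n)) σ := by
  have h (α : n.Partition) (σ : Perm (Fin n)) : σ.partition.parts = α.parts ↔
      (⟨σ.partition.parts, σ.partition.parts_pos, sum_parts_partition σ⟩ : n.Partition) = α := by
    rw [Nat.Partition.ext_iff]
  rw [← Finset.sum_fiberwise (g := fun σ : Perm (Fin n) =>
    (⟨σ.partition.parts, σ.partition.parts_pos, sum_parts_partition σ⟩ : n.Partition))]
  refine Finset.sum_congr rfl fun α _ => ?_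
  rw [classSum, Finset.smul_sum]
  simp only [← h]
  refine Finset.sum_congr rfl fun σ hσ => ?_
  rw [(Finset.mem_filter.1 hσ).2]

theorem sum_smul_of_mem_center {n : ℕ} (c : Multiset ℕ → ℂ) :
    ∑ σ : Perm (Fin n), c σ.partition.parts • MonoidAlgebra.of ℂ (Perm (Fin n)) σ ∈
      Subalgebra.center ℂ (GroupAlg n) := by
  rw [Subalgebra.mem_center_iff]
  intro b
  induction b using MonoidAlgebra.induction_on with
  | of τ =>
    rw [Finset.mul_sum, Finset.sum_mul]
    refine Fintype.sum_equiv (MulAut.conj τ).toEquiv _ _ fun σ => ?_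
    have : ((MulAut.conj τ) σ).partition = σ.partition :=
      (Perm.partition_eq_of_isConj.1 (isConj_iff.2 ⟨τ, rfl⟩)).symm
    rw [MulEquiv.toEquiv_eq_coe, MulEquiv.coe_toEquiv, this, mul_smul_comm, smul_mul_assoc,
      ← map_mul, ← map_mul, MulAut.conj_apply, inv_mul_cancel_right]
  | add x y hx hy => rw [add_mul, mul_add, hx, hy]
  | smul z x hx => rw [smul_mul_assoc, mul_smul_comm, hx]

theorem card_starWords_eq_sum {n : ℕ} (hn : 1 ≤ n) (i : Fin n) (r : ℕ) (σ : Perm (Fin n)) :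
    ((starWords i r (Finset.univ.erase i) σ).card : ℂ) =
      ∑ g ∈ Finset.range (r + 1) with n + σ.partition.parts.card - 2 + 2 * g = r,
        (a g σ.partition.parts : ℂ) := by
  set s := σ.partition.parts with hs
  have hsum : s.sum = n := sum_parts_partition σ
  have hcard : 2 ≤ s.sum + s.card := by
    have : s ≠ 0 := by
      intro h
      rw [h, Multiset.sum_zero] at hsum
      omega
    have := Multiset.card_pos.2 this
    rw [hsum]
    omega
  have key : ((starWords i r (Finset.univ.erase i) σ).card : ℚ) =
      ∑ g ∈ Finset.range (r + 1) with n + s.card - 2 + 2 * g = r, a g s := by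
    rw [card_starWords_univ i r hs.symm]
    by_cases hr : ∃ g, n + s.card - 2 + 2 * g = r
    · obtain ⟨g, rfl⟩ := hr
      have := factorial_mul_coeff_starSeries s hcard g
      rw [hsum] at this
      rw [this, Finset.sum_eq_single_of_mem g]
      · exact Finset.mem_filter.2 ⟨Finset.mem_range.2 (by omega), rfl⟩
      · intro g' hg' hne
        have := (Finset.mem_filter.1 hg').2
        omega
    · rw [coeff_starSeries_eq_zero s hcard r fun g hg => hr ⟨g, hsum ▸ hg⟩, mul_zero,
        Finset.filter_false_of_mem fun g _ hg => hr ⟨g, hg⟩, Finset.sum_empty]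
  exact_mod_cast congrArg (fun x : ℚ => (x : ℂ)) key

theorem transPow_expansion (n : ℕ) (hn : 1 ≤ n) (r : ℕ) :
    transPow n hn r ∈ Subalgebra.center ℂ (GroupAlg n) ∧
      transPow n hn r = ∑ α : n.Partition,
        ∑ g ∈ Finset.range (r + 1) with n + α.parts.card - 2 + 2 * g = r,
          (a g α.parts : ℂ) • classSum α := by
  set c : Multiset ℕ → ℂ := fun s =>
    ∑ g ∈ Finset.range (r + 1) with n + s.card - 2 + 2 * g = r, (a g s : ℂ) with hc
  have h : transPow n hn r =
      ∑ σ : Perm (Fin n), c σ.partition.parts • MonoidAlgebra.of ℂ (Perm (Fin n)) σ := by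
    rw [transPow_eq_sum]
    exact Finset.sum_congr rfl fun σ _ => by rw [card_starWords_eq_sum hn]
  refine ⟨h ▸ sum_smul_of_mem_center c, ?_⟩
  rw [h, ← sum_smul_classSum]
  exact Finset.sum_congr rfl fun α _ => Finset.sum_smul

/-! ### Polynomiality -/

/-- The functions of `m` natural numbers that are given by a rational polynomial. -/
def polyFun (m : ℕ) : Subalgebra ℚ ((Fin m → ℕ) → ℚ) :=
  (MvPolynomial.aeval fun (i : Fin m) (α : Fin m → ℕ) => (α i : ℚ)).range

theorem exists_of_mem_polyFun {m : ℕ} {F : (Fin m → ℕ) → ℚ} (hF : F ∈ polyFun m) :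
    ∃ P : MvPolynomial (Fin m) ℚ, ∀ α, F α = MvPolynomial.eval (fun i => (α i : ℚ)) P := by
  obtain ⟨P, rfl⟩ := (AlgHom.mem_range _).1 hF
  refine ⟨P, fun α => ?_⟩
  have := DFunLike.congr_fun (MvPolynomial.comp_aeval (R := ℚ)
    (fun (i : Fin m) (α : Fin m → ℕ) => (α i : ℚ)) (Pi.evalAlgHom ℚ (fun _ => ℚ) α)) P
  exact this

theorem proj_mem_polyFun {m : ℕ} (i : Fin m) : (fun α : Fin m → ℕ => (α i : ℚ)) ∈ polyFun m :=
  ⟨MvPolynomial.X i, by simp⟩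

theorem const_mem_polyFun {m : ℕ} (c : ℚ) : (fun _ : Fin m → ℕ => c) ∈ polyFun m :=
  (polyFun m).algebraMap_mem c

theorem p_mem_polyFun (m j : ℕ) :
    (fun α : Fin m → ℕ => p j (Finset.univ.val.map α)) ∈ polyFun m := by
  have : (fun α : Fin m → ℕ => p j (Finset.univ.val.map α)) =
      ∑ i : Fin m, (fun α : Fin m → ℕ => (α i : ℚ)) ^ j := by
    funext α
    rw [p_eq, Multiset.map_map, Finset.sum_apply]
    rfl
  rw [this]
  exact sum_mem fun i _ => pow_mem (proj_mem_polyFun i) j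

theorem Q_mem_polyFun (m g : ℕ) :
    (fun α : Fin m → ℕ => Q g (Finset.univ.val.map α)) ∈ polyFun m := by
  have : (fun α : Fin m → ℕ => Q g (Finset.univ.val.map α)) =
      ∑ β : g.Partition, ((β.parts.map fun j => xi (2 * j)).prod / (autCard β.parts : ℚ)) •
        (β.parts.map fun j => fun α : Fin m → ℕ => q (2 * j) (Finset.univ.val.map α)).prod := by
    funext α
    rw [Q, Finset.sum_apply]
    refine Finset.sum_congr rfl fun β _ => ?_
    rw [Pi.smul_apply, Pi.multiset_prod_apply, Multiset.map_map, smul_eq_mul]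
    simp only [Function.comp_def]
    ring
  rw [this]
  refine sum_mem fun β _ => (polyFun m).smul_mem (multiset_prod_mem _ fun F hF => ?_) _
  obtain ⟨j, -, rfl⟩ := Multiset.mem_map.1 hF
  exact sub_mem (add_mem (p_mem_polyFun m _) (p_mem_polyFun m 1)) (const_mem_polyFun 2)

theorem exists_polynomial (g m : ℕ) (hm : 1 ≤ m) : ∃ P : MvPolynomial (Fin m) ℚ,
    ∀ α : Fin m → ℕ, (∀ i, 1 ≤ α i) →
      a g (Finset.univ.val.map α) = MvPolynomial.eval (fun i => (α i : ℚ)) P := by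
  have hsum : (fun α : Fin m → ℕ => ((∑ i, α i : ℕ) : ℚ)) ∈ polyFun m := by
    have : (fun α : Fin m → ℕ => ((∑ i, α i : ℕ) : ℚ)) = ∑ i, fun α : Fin m → ℕ => (α i : ℚ) := by
      funext α
      simp
    rw [this]
    exact sum_mem fun i _ => proj_mem_polyFun i
  have hprod : (fun α : Fin m → ℕ => ((∏ i, α i : ℕ) : ℚ)) ∈ polyFun m := by
    have : (fun α : Fin m → ℕ => ((∏ i, α i : ℕ) : ℚ)) = ∏ i, fun α : Fin m → ℕ => (α i : ℚ) := by
      funext α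
      simp
    rw [this]
    exact prod_mem fun i _ => proj_mem_polyFun i
  have hfac (e : ℕ) : (fun α : Fin m → ℕ => (((∑ i, α i) + e).factorial : ℚ) /
      ((∑ i, α i).factorial : ℚ)) ∈ polyFun m := by
    induction e with
    | zero =>
      convert const_mem_polyFun (m := m) 1 using 2 with α
      exact div_self (by positivity)
    | succ e ih =>
      convert mul_mem ih (add_mem hsum (const_mem_polyFun (e + 1))) using 2 with α
      simp only [Pi.mul_apply, Pi.add_apply, ← add_assoc, Nat.factorial_succ]
      push_cast
      ring
  by_cases h : m + 2 * g < 2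
  -- One cycle and genus zero: the factorial quotient is `1 / n`, which is not a polynomial, but
  -- the product of the parts is `n`.
  · obtain ⟨rfl, rfl⟩ : m = 1 ∧ g = 0 := by omega
    refine ⟨1, fun α hα => ?_⟩
    obtain ⟨k, hk⟩ := Nat.exists_eq_add_of_le' (hα 0)
    have hk' : ((k : ℚ) + 1) * k.factorial ≠ 0 := by positivity
    simp only [a, Q_eq_partSum, partSum_zero]
    simp [hk, Nat.factorial_succ]
    field_simp
  · obtain ⟨P, hP⟩ := exists_of_mem_polyFun
      (mul_mem (mul_mem (hfac (m + 2 * g - 2)) hprod) (Q_mem_polyFun m g))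
    refine ⟨P, fun α hα => ?_⟩
    rw [← hP]
    have hs : (Finset.univ.val.map α).sum = ∑ i, α i := rfl
    have hp : (Finset.univ.val.map α).prod = ∏ i, α i := rfl
    have hc : (Finset.univ.val.map α).card = m := by simp
    rw [a, hs, hp, hc]
    have hpos : 1 ≤ ∑ i, α i :=
      (hα ⟨0, hm⟩).trans (Finset.single_le_sum (fun _ _ => Nat.zero_le _) (Finset.mem_univ _))
    rw [show ∑ i, α i + m - 2 + 2 * g = ∑ i, α i + (m + 2 * g - 2) by omega]
    rfl

end StarFact

end

open StarFact in
theorem theorem1 :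
    -- centrality and expansion in the class basis
    (∀ (n : ℕ) (hn : 1 ≤ n) (r : ℕ),
      transPow n hn r ∈ Subalgebra.center ℂ (GroupAlg n) ∧
      transPow n hn r =
        ∑ α : n.Partition,
          ∑ g ∈ Finset.range (r + 1) with n + α.parts.card - 2 + 2 * g = r,
            (StarFact.a g α.parts : ℂ) • classSum α) ∧
    -- for fixed `g` and `m`, `a_g(α)` is a polynomial in the `m` parts of `α`
    (∀ (g m : ℕ), 1 ≤ m → ∃ P : MvPolynomial (Fin m) ℚ,
      ∀ α : Fin m → ℕ, (∀ i, 1 ≤ α i) →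
        StarFact.a g (Finset.univ.val.map α) = MvPolynomial.eval (fun i => (α i : ℚ)) P) ∧
    -- `a_g(α)` counts transitive star factorizations
    (∀ (n : ℕ), 1 ≤ n → ∀ (α : n.Partition) (g : ℕ) (pivot : Fin n) (σ : Perm (Fin n)),
      σ.partition.parts = α.parts →
        ((starFactorizations pivot (n + α.parts.card - 2 + 2 * g) σ).ncard : ℚ)
          = StarFact.a g α.parts) ∧
    -- the case of genus zero
    (∀ (n : ℕ), 1 ≤ n → ∀ (α : n.Partition) (pivot : Fin n) (σ : Perm (Fin n)),
      σ.partition.parts = α.parts →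
        ((starFactorizations pivot (n + α.parts.card - 2) σ).ncard : ℚ)
          = ((n + α.parts.card - 2).factorial : ℚ) / (n.factorial : ℚ) * (α.parts.prod : ℚ)) := by
  refine ⟨transPow_expansion, exists_polynomial,
    fun n hn α g i σ hσ => ncard_starFactorizations_eq hn α g i σ hσ, fun n hn α i σ hσ => ?_⟩
  have h := ncard_starFactorizations_eq hn α 0 i σ hσ
  rw [mul_zero, add_zero] at h
  rw [h, StarFact.a, Q_eq_partSum, partSum_zero, α.parts_sum, mul_zero, add_zero, mul_one]
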